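/- For a group $G$ and subgroups $H,K\le G$ write $[H,\,_0K]=H$ and $[H,\,_{k+1}K]=[[H,\,_kK],K]$. Let $\gamma_k(F)$ be the $k$-th term of the lower central series of a group $F$ (with $\gamma_1(F)=F$). For a group $G$ with a free presentation $1\to R\to F\to G\to 1$ ($F$ free) and $c\ge 1$, put $$\mathcal N_cM(G)=\bigl(R\cap\gamma_{c+1}(F)\bigr)/[R,\,_cF],$$ the Baer invariant of $G$ with respect to the variety of nilpotent groups of class at most $c$; it does not depend, up to isomorphism, on the free presentation. For positive integers $r,s$ and $n\geq 1$ let $$G_{(r,s,n)}=(\mathbb Z_r * \mathbb Z_s)\,/\,[\mathbb Z_r,\mathbb Z_s,\,_{n-1}(\mathbb Z_r*\mathbb Z_s)]$$ be the $n$-th nilpotent product of the cyclic groups $\mathbb Z_r,\mathbb Z_s$ of orders $r$ and $s$, where $\mathbb Z_r*\mathbb Z_s$ is the free product. Let $d=\gcd(r,s)$, and let $r(k)$ be the number of basic commutators of weight $k$ on two letters. These are defined as follows, with formal commutators ordered totally so that smaller weight comes first: the two letters are the basic commutators of weight $1$, and $[u,v]$ is basic of weight $\mathrm{wt}(u)+\mathrm{wt}(v)$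 if $u,v$ are basic, $u>v$, and $b\le v$ whenever $u=[a,b]$. **Theorem 3.5.** (i) If $r$ and $s$ are odd and $c\ge 2$, then for every free presentation of $G_{(r,s,2)}$ the group $\mathcal N_cM(G_{(r,s,2)})$ is isomorphic to the direct sum of $\sum_{i=1}^{2} r(c+i)$ copies of $\mathbb Z_d$. (ii) If neither $r$ nor $s$ is divisible by $2$ or by $3$, then for every $c\ge 3$ and every free presentation of $G_{(r,s,3)}$ the group $\mathcal N_cM(G_{(r,s,3)})$ is isomorphic to the direct sum of $\sum_{i=1}^{3} r(c+i)$ copies of $\mathbb Z_d$, and for every $c\ge 4$ and every free presentation of $G_{(r,s,4)}$ the group $\mathcal N_cM(G_{(r,s,4)})$ is isomorphic to the direct sum of $\sum_{i=1}^{4} r(c+i)$ copies of $\mathbb Z_d$. -/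

import Mathlib

/-- `[H, _k K] = [⋯[[H, K], K], …, K]` with `k` copies of the subgroup `K`. -/
def iteratedCommutator {G : Type*} [Group G] (H K : Subgroup G) : ℕ → Subgroup G
  | 0 => H
  | k + 1 => ⁅iteratedCommutator H K k, K⁆

instance iteratedCommutator_top_normal {G : Type*} [Group G] (H : Subgroup G) [hH : H.Normal]
    (k : ℕ) : (iteratedCommutator H ⊤ k).Normal := by
  induction k with
  | zero => exact hH
  | succ k ih => exact Subgroup.commutator_normal _ _

/-- The subgroup `[A, B, _(n-1) (A ∗ B)]` of the free product `A ∗ B`, for `n ≥ 1`. -/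
def nilpotentProductKernel (n : ℕ) (A B : Type*) [Group A] [Group B] :
    Subgroup (Monoid.Coprod A B) :=
  iteratedCommutator
    ⁅(Monoid.Coprod.inl : A →* Monoid.Coprod A B).range,
      (Monoid.Coprod.inr : B →* Monoid.Coprod A B).range⁆ ⊤ (n - 1)

instance nilpotentProductKernel_normal (n : ℕ) (A B : Type*) [Group A] [Group B] :
    (nilpotentProductKernel n A B).Normal := by
  have h : (⁅(Monoid.Coprod.inl : A →* Monoid.Coprod A B).range,
      (Monoid.Coprod.inr : B →* Monoid.Coprod A B).range⁆).Normal := by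
    rw [← Subgroup.normalizer_eq_top_iff, eq_top_iff, ← Monoid.Coprod.range_inl_sup_range_inr]
    exact sup_le (Subgroup.normalizer_commutator_ge_left _ _)
      (Subgroup.normalizer_commutator_ge_right _ _)
  exact iteratedCommutator_top_normal _ _

/-- The `n`-th nilpotent product of `A` and `B`, for `n ≥ 1`: the quotient of the free product
`A ∗ B` by `[A, B, _(n-1) (A ∗ B)]`. -/
abbrev NilpotentProduct (n : ℕ) (A B : Type*) [Group A] [Group B] : Type _ :=
  Monoid.Coprod A B ⧸ nilpotentProductKernel n A B

/-- The `n`-th nilpotent product of the cyclic groups of orders `r` and `s`. -/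
abbrev CyclicNilpotentProduct (r s n : ℕ) : Type :=
  NilpotentProduct n (Multiplicative (ZMod r)) (Multiplicative (ZMod s))

/-- For a presentation `π : F → G` with kernel `R`, the group `(R ∩ γ_{c+1}(F)) / [R, _c F]`.
Here `(⊤ : Subgroup F).lowerCentralSeries c` is `γ_{c+1}(F)`, since Mathlib counts from `0`.
When `F` is free and `π` is surjective, this is the Baer invariant of `G` with respect to the
variety of nilpotent groups of class at most `c`. -/
abbrev BaerInvariant {F G : Type*} [Group F] [Group G] (c : ℕ) (π : F →* G) : Type _ :=
  ↥(π.ker ⊓ (⊤ : Subgroup F).lowerCentralSeries c) ⧸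
    (iteratedCommutator π.ker ⊤ c).subgroupOf (π.ker ⊓ (⊤ : Subgroup F).lowerCentralSeries c)

/-- The order on formal commutators in two letters: smaller weight first, and lexicographic
among commutators of the same weight. The weight is `FreeMagma.length`, the number of letters,
and `u * v` in the free magma stands for the formal commutator `[u, v]`. -/
def commutatorLT : FreeMagma (Fin 2) → FreeMagma (Fin 2) → Prop
  | .of i, .of j => i < j
  | .of _, .mul _ _ => True
  | .mul _ _, .of _ => False
  | .mul a b, .mul c d =>
      a.length + b.length < c.length + d.length ∨
        a.length + b.length = c.length + d.length ∧
          (commutatorLT a c ∨ a = c ∧ commutatorLT b d)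

/-- Basic commutators on two letters: the letters are basic, and `[u, v]` is basic when `u` and
`v` are basic, `u > v`, and `b ≤ v` in case `u = [a, b]`. -/
inductive IsBasicCommutator : FreeMagma (Fin 2) → Prop
  | letter (i : Fin 2) : IsBasicCommutator (.of i)
  | bracket (u v : FreeMagma (Fin 2)) (hu : IsBasicCommutator u) (hv : IsBasicCommutator v)
      (hlt : commutatorLT v u)
      (hle : ∀ a b : FreeMagma (Fin 2), u = a * b → b = v ∨ commutatorLT b v) :
      IsBasicCommutator (u * v)

/-- The number of basic commutators of weight `k` on two letters. -/
noncomputable def numBasicCommutators (k : ℕ) : ℕ :=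
  {t : FreeMagma (Fin 2) | IsBasicCommutator t ∧ t.length = k}.ncard

/-!
Let `F` be free on two letters, `R` the kernel of the standard presentation of the `n`-th nilpotent
product of the cyclic groups of orders `r` and `s`, and `d = gcd r s`. By a standard argument
(`BaerInvariant.nonempty_mulEquiv`) the Baer invariant does not depend on the presentation, so only
`F` matters. Here `R` is the normal closure of the two powers of the letters and of `γ_(n+1)(F)`
(`gammaTerm_le_ker`, `ker_cyclicPresentation_le`). For `c ≥ n` it contains `γ_(c+1)(F)`, and the
invariant is `γ_(c+1)(F) / N` with `N = [R, _c F] ≥ γ_(c+n+1)(F)`. The group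
`γ_(c+1)(F) / γ_(c+n+1)(F)` is free abelian on the basic commutators of weights `c + 1, …, c + n`,
and the claim is that `N` corresponds to its `d`-th powers. This holds as soon as `r` divides
`r.choose i` and `s` divides `s.choose i` for `1 ≤ i ≤ n`, which is where the conditions on the
primes `2` and `3` enter.

*Basic commutators.* They span `γ_k / γ_(k+1)` by repeated use of the Jacobi identity
(`commutator_groupCommutator_mem_basicTerm`, `basicTerm_eq_gammaTerm`). The Magnus representation
`x_i ↦ 1 + x_i X` into the power series over the free ring sends a group commutator of weight `k` to
`1 + X ^ k (…)`, with the ring commutator as leading coefficient; so independence is a question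
about the free ring. A nondecreasing list of basic commutators is recovered from the word that
concatenates its letters (`factorWord_flatMap`), and the nondecreasing products of basic commutators
span the free ring (`ringCommutatorProd_mem_span_sorted`). Hence the linear map that sends a word to
the product of the basic commutators in its factorization is onto. The module spanned by the words
of bounded length is finitely generated and covered by its own elements, so the map is also
injective (`factorizationMap_injective`). The products, one for each word, are therefore a basis;
this gives independence over the integers and modulo every `d`
(`exists_basicCommutatorsIndependent`).

*The subgroup `N`.* Since `(1 + a X) ^ r - 1` lies in the ideal `(d X, X ^ (n+1))`, the Magnus
image of `R` is trivial modulo this ideal, and each commutator with `F` gains a factor `X`. So `N`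
has trivial image modulo `X ^ (c+1) (d, X ^ n)`, and a product of powers of basic commutators in `N`
has exponents divisible by `d` (`dvd_of_magnus_powerProduct_mem`). Conversely the `d`-th powers of
`γ_k` lie in `[R, _(k-1) F] γ_(k+1)`, because `[x_0, x_1] ^ r` and `[x_0, x_1] ^ s` are congruent to
`[x_0 ^ r, x_1]` and `[x_0, x_1 ^ s]` (`pow_gcd_mem_sup`). The error term in `γ_(k+1)` has trivial
image modulo `d` as well, hence is again a `d`-th power up to `γ_(c+n+1)`, and descending induction
on `k` gives `γ_(c+1) ^ d ≤ N` (`pow_mem_iteratedCommutator_ker`).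
-/

/-! ### Commutator calculus along the lower central series -/

/-- The `k`-th term `γ_k(G)` of the lower central series, indexed by weight: `γ_1(G) = G`, and
`γ_0(G) = G` by convention, so that `[γ_i, γ_j] ≤ γ_(i+j)` holds for all `i` and `j`. -/
def gammaTerm (G : Type*) [Group G] (k : ℕ) : Subgroup G :=
  (⊤ : Subgroup G).lowerCentralSeries (k - 1)

open scoped commutatorElement

section GammaTerm

variable {G : Type*} [Group G]

instance gammaTerm_normal (k : ℕ) : (gammaTerm G k).Normal := by
  unfold gammaTerm; infer_instance

theorem gammaTerm_succ {k : ℕ} (hk : 1 ≤ k) : gammaTerm G (k + 1) = ⁅gammaTerm G k, ⊤⁆ := by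
  obtain ⟨k, rfl⟩ := Nat.exists_eq_add_of_le' hk
  rfl

theorem gammaTerm_antitone : Antitone (gammaTerm G) := fun _ _ h =>
  Subgroup.lowerCentralSeries_antitone _ (Nat.sub_le_sub_right h 1)

theorem map_gammaTerm_le {H : Type*} [Group H] (f : G →* H) (k : ℕ) :
    (gammaTerm G k).map f ≤ gammaTerm H k := by
  rw [gammaTerm, Subgroup.map_lowerCentralSeries]
  exact Subgroup.lowerCentralSeries_mono _ le_top

/-- The three subgroups lemma, relative to a normal subgroup. -/
theorem commutator_commutator_le_of_rotate {A B C N : Subgroup G} [hN : N.Normal]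
    (h1 : ⁅⁅B, C⁆, A⁆ ≤ N) (h2 : ⁅⁅C, A⁆, B⁆ ≤ N) : ⁅⁅A, B⁆, C⁆ ≤ N := by
  have key : ∀ K : Subgroup G, K ≤ N ↔ K.map (QuotientGroup.mk' N) = ⊥ := fun K => by
    rw [Subgroup.map_eq_bot_iff, QuotientGroup.ker_mk']
  rw [key] at h1 h2 ⊢
  simp only [Subgroup.map_commutator] at h1 h2 ⊢
  exact Subgroup.commutator_commutator_eq_bot_of_rotate h1 h2

theorem iteratedCommutator_mono {H H' : Subgroup G} (h : H ≤ H') (k : ℕ) :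
    iteratedCommutator H ⊤ k ≤ iteratedCommutator H' ⊤ k := by
  induction k with
  | zero => exact h
  | succ k ih => exact Subgroup.commutator_mono ih le_rfl

theorem iteratedCommutator_commutator (H : Subgroup G) (k : ℕ) :
    iteratedCommutator ⁅H, ⊤⁆ ⊤ k = iteratedCommutator H ⊤ (k + 1) := by
  induction k with
  | zero => rfl
  | succ k ih => rw [iteratedCommutator, ih]; rfl

theorem iteratedCommutator_antitone (H : Subgroup G) [H.Normal] :
    Antitone (iteratedCommutator H ⊤) :=
  antitone_nat_of_succ_le fun _ => Subgroup.commutator_le_left _ _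

theorem iteratedCommutator_gammaTerm {i : ℕ} (hi : 1 ≤ i) (k : ℕ) :
    iteratedCommutator (gammaTerm G i) ⊤ k = gammaTerm G (i + k) := by
  induction k with
  | zero => rfl
  | succ k ih => rw [iteratedCommutator, ih, ← add_assoc, gammaTerm_succ (by omega)]

theorem commutator_gammaTerm_le_iteratedCommutator (H : Subgroup G) [hH : H.Normal] (k : ℕ) :
    ⁅gammaTerm G k, H⁆ ≤ iteratedCommutator H ⊤ k := by
  induction k generalizing H with
  | zero => exact Subgroup.commutator_le_right _ _
  | succ k ih =>
    rcases Nat.eq_zero_or_pos k with rfl | hk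
    · exact (Subgroup.commutator_comm _ _).le
    rw [gammaTerm_succ hk]
    have := iteratedCommutator_top_normal H (k + 1)
    apply commutator_commutator_le_of_rotate
    · rw [Subgroup.commutator_comm ⊤ H, Subgroup.commutator_comm ⁅H, ⊤⁆]
      exact (ih ⁅H, ⊤⁆).trans (iteratedCommutator_commutator H k).le
    · rw [Subgroup.commutator_comm H]
      exact Subgroup.commutator_mono (ih H) le_rfl

theorem commutator_gammaTerm_le (i j : ℕ) :
    ⁅gammaTerm G i, gammaTerm G j⁆ ≤ gammaTerm G (i + j) := by
  rcases Nat.eq_zero_or_pos j with rfl | hj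
  · exact Subgroup.commutator_le_left _ _
  · rw [add_comm]
    exact (commutator_gammaTerm_le_iteratedCommutator _ i).trans
      (iteratedCommutator_gammaTerm hj i).le

theorem commutator_mem_gammaTerm {i j n : ℕ} {a b : G} (ha : a ∈ gammaTerm G i)
    (hb : b ∈ gammaTerm G j) (hn : n ≤ i + j) : ⁅a, b⁆ ∈ gammaTerm G n :=
  gammaTerm_antitone hn (commutator_gammaTerm_le i j (Subgroup.commutator_mem_commutator ha hb))

theorem commutator_mem_gammaTerm_succ {n : ℕ} {a : G} (ha : a ∈ gammaTerm G n) (b : G) :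
    ⁅a, b⁆ ∈ gammaTerm G (n + 1) :=
  commutator_mem_gammaTerm (j := 1) ha (Subgroup.mem_top b) le_rfl

theorem commute_mk_of_mem_gammaTerm {n : ℕ} {z : G} (hz : z ∈ gammaTerm G n)
    (g : G ⧸ gammaTerm G (n + 1)) : Commute (z : G ⧸ gammaTerm G (n + 1)) g := by
  induction g using QuotientGroup.induction_on with
  | H g =>
    rw [← commutatorElement_eq_one_iff_commute]
    have h := (QuotientGroup.eq_one_iff _).2 (commutator_mem_gammaTerm_succ hz g)
    rwa [← QuotientGroup.mk'_apply, map_commutatorElement] at h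

theorem mk_commutator_mul_left {i j n : ℕ} {a a' b : G} (ha' : a' ∈ gammaTerm G i)
    (hb : b ∈ gammaTerm G j) (hn : i + j = n) :
    ((⁅a * a', b⁆ : G) : G ⧸ gammaTerm G (n + 1)) = (⁅a, b⁆ : G) * (⁅a', b⁆ : G) := by
  have h := commute_mk_of_mem_gammaTerm (commutator_mem_gammaTerm ha' hb hn.ge)
  have e : ⁅a * a', b⁆ = a * ⁅a', b⁆ * a⁻¹ * ⁅a, b⁆ := by
    simp only [commutatorElement_def]; group
  rw [e]
  simp only [QuotientGroup.mk_mul, QuotientGroup.mk_inv]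
  rw [← (h a).eq, mul_inv_cancel_right, (h _).eq]

theorem mk_commutator_inv_left {i j n : ℕ} {a b : G} (ha : a ∈ gammaTerm G i)
    (hb : b ∈ gammaTerm G j) (hn : i + j = n) :
    ((⁅a⁻¹, b⁆ : G) : G ⧸ gammaTerm G (n + 1)) = ((⁅a, b⁆ : G) : G ⧸ gammaTerm G (n + 1))⁻¹ := by
  rw [eq_comm, inv_eq_iff_mul_eq_one, ← mk_commutator_mul_left (inv_mem ha) hb hn]
  simp

theorem mk_commutator_swap (n : ℕ) (a b : G) :
    ((⁅a, b⁆ : G) : G ⧸ gammaTerm G n) = ((⁅b, a⁆ : G) : G ⧸ gammaTerm G n)⁻¹ := by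
  rw [← QuotientGroup.mk_inv, commutatorElement_inv]

theorem mk_commutator_inv_right {i j n : ℕ} {a b : G} (ha : a ∈ gammaTerm G i)
    (hb : b ∈ gammaTerm G j) (hn : i + j = n) :
    ((⁅a, b⁻¹⁆ : G) : G ⧸ gammaTerm G (n + 1)) = ((⁅a, b⁆ : G) : G ⧸ gammaTerm G (n + 1))⁻¹ := by
  rw [mk_commutator_swap, mk_commutator_inv_left hb ha (by omega), ← mk_commutator_swap]

theorem mk_commutator_pow_left {i j n : ℕ} {a b : G} (ha : a ∈ gammaTerm G i)
    (hb : b ∈ gammaTerm G j) (hn : i + j = n) (m : ℕ) :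
    ((⁅a ^ m, b⁆ : G) : G ⧸ gammaTerm G (n + 1)) =
      ((⁅a, b⁆ : G) : G ⧸ gammaTerm G (n + 1)) ^ m := by
  induction m with
  | zero => simp
  | succ m ih => rw [pow_succ, mk_commutator_mul_left ha hb hn, ih, pow_succ]

theorem mk_commutator_congr_left {i j n : ℕ} {a a' b : G} (hb : b ∈ gammaTerm G j)
    (h : (a : G ⧸ gammaTerm G (i + 1)) = a') (hn : i + j = n) :
    ((⁅a, b⁆ : G) : G ⧸ gammaTerm G (n + 1)) = (⁅a', b⁆ : G) := by
  have hw : a⁻¹ * a' ∈ gammaTerm G (i + 1) := QuotientGroup.eq.1 h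
  have hz : (⁅a⁻¹ * a', b⁆ : G) ∈ gammaTerm G (n + 1) :=
    commutator_mem_gammaTerm hw hb (by omega)
  have e := mk_commutator_mul_left (a := a) (gammaTerm_antitone (Nat.le_succ i) hw) hb hn
  rw [mul_inv_cancel_left, (QuotientGroup.eq_one_iff _).2 hz, mul_one] at e
  exact e.symm

/-- The Jacobi identity in the graded Lie ring of the lower central series. -/
theorem mk_commutator_jacobi {i j l n : ℕ} {x y z : G} (hx : x ∈ gammaTerm G i)
    (hy : y ∈ gammaTerm G j) (hz : z ∈ gammaTerm G l) (hn : i + j + l = n) :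
    ((⁅⁅x, y⁆, z⁆ : G) : G ⧸ gammaTerm G (n + 1)) = (⁅⁅x, z⁆, y⁆ : G) * (⁅x, ⁅y, z⁆⁆ : G) := by
  have m1 : ⁅z⁻¹, x⁻¹⁆ ∈ gammaTerm G (l + i) :=
    commutator_mem_gammaTerm (inv_mem hz) (inv_mem hx) le_rfl
  have m2 : ⁅y⁻¹, z⁆ ∈ gammaTerm G (j + l) :=
    commutator_mem_gammaTerm (inv_mem hy) hz le_rfl
  have h1 := commute_mk_of_mem_gammaTerm
    (commutator_mem_gammaTerm hy m1 (n := n) (by omega))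
  have h2 := commute_mk_of_mem_gammaTerm
    (commutator_mem_gammaTerm (inv_mem hx) m2 (n := n) (by omega))
  -- The Hall–Witt identity; in the quotient all conjugations become trivial.
  have hallWitt : ⁅⁅x, y⁆, z⁆ =
      x * y * ⁅x⁻¹, ⁅y⁻¹, z⁆⁆ * y⁻¹ * z * ⁅y, ⁅z⁻¹, x⁻¹⁆⁆ * z⁻¹ * x⁻¹ := by
    simp only [commutatorElement_def]; group
  have e1 : ((⁅y, ⁅z⁻¹, x⁻¹⁆⁆ : G) : G ⧸ gammaTerm G (n + 1)) = (⁅⁅x, z⁆, y⁆ : G) := by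
    have hc : ((⁅z⁻¹, x⁻¹⁆ : G) : G ⧸ gammaTerm G (l + i + 1)) = ((⁅x, z⁆⁻¹ : G) : _) := by
      rw [mk_commutator_inv_left hz (inv_mem hx) rfl, mk_commutator_inv_right hz hx rfl, inv_inv,
        commutatorElement_inv]
    rw [mk_commutator_swap, mk_commutator_congr_left hy hc (by omega),
      mk_commutator_inv_left (commutator_mem_gammaTerm hx hz le_rfl) hy (by omega), inv_inv]
  have e2 : ((⁅x⁻¹, ⁅y⁻¹, z⁆⁆ : G) : G ⧸ gammaTerm G (n + 1)) = (⁅x, ⁅y, z⁆⁆ : G) := by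
    rw [mk_commutator_inv_left hx m2 (by omega), ← mk_commutator_swap,
      mk_commutator_congr_left hx (i := j + l) (a' := ⁅y, z⁆⁻¹) _ (by omega),
      mk_commutator_inv_left (commutator_mem_gammaTerm hy hz le_rfl) hx (by omega),
      ← mk_commutator_swap]
    rw [mk_commutator_inv_left hy hz rfl]; rfl
  rw [hallWitt]
  simp only [QuotientGroup.mk_mul, QuotientGroup.mk_inv]
  rw [← e1, ← e2]
  calc _ = (x : G ⧸ gammaTerm G (n + 1)) *
        (y * ((⁅x⁻¹, ⁅y⁻¹, z⁆⁆ : G) : G ⧸ gammaTerm G (n + 1))) * (y : G ⧸ gammaTerm G (n + 1))⁻¹ *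
        (z * ((⁅y, ⁅z⁻¹, x⁻¹⁆⁆ : G) : G ⧸ gammaTerm G (n + 1))) * (z : G ⧸ gammaTerm G (n + 1))⁻¹ *
        (x : G ⧸ gammaTerm G (n + 1))⁻¹ := by simp only [mul_assoc]
    _ = _ := by
      rw [← (h1 z).eq, ← (h2 y).eq]
      simp only [mul_assoc, mul_inv_cancel_left]
      rw [← mul_assoc, ← (h2 x).eq, mul_assoc, ← mul_assoc (x : G ⧸ gammaTerm G (n + 1)),
        ← (h1 x).eq, mul_assoc, mul_inv_cancel, mul_one, (h1 _).eq]

end GammaTerm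

/-! ### Independence of the free presentation -/

section Presentation

variable {F F' G : Type*} [Group F] [Group F'] [Group G]

/-- A homomorphism out of a free group lifts through a surjection. -/
theorem IsFreeGroup.exists_lift [IsFreeGroup F] (π : F →* G) (π' : F' →* G)
    (h : Function.Surjective π') : ∃ f : F →* F', π'.comp f = π := by
  refine ⟨IsFreeGroup.lift fun a => Function.surjInv h (π (IsFreeGroup.of a)), ?_⟩
  apply IsFreeGroup.ext_hom
  intro a
  simp [Function.surjInv_eq h]

theorem map_iteratedCommutator_le (f : F →* F') {H : Subgroup F} {H' : Subgroup F'}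
    (h : H.map f ≤ H') (c : ℕ) :
    (iteratedCommutator H ⊤ c).map f ≤ iteratedCommutator H' ⊤ c := by
  induction c with
  | zero => exact h
  | succ c ih =>
    rw [iteratedCommutator, Subgroup.map_commutator]
    exact Subgroup.commutator_mono ih le_top

theorem map_ker_le {π : F →* G} {π' : F' →* G} {f : F →* F'} (h : π'.comp f = π) :
    π.ker.map f ≤ π'.ker := by
  rintro _ ⟨x, hx, rfl⟩
  rw [MonoidHom.mem_ker, ← MonoidHom.comp_apply, h]
  exact hx

/-- An endomorphism of `F` over `G` acts trivially on `γ_(c+1)(F)` modulo `[R, _c F]`. -/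
theorem inv_mul_mem_iteratedCommutator_ker {π : F →* G} {f : F →* F} (h : π.comp f = π) (c : ℕ)
    {w : F} (hw : w ∈ gammaTerm F (c + 1)) :
    (f w)⁻¹ * w ∈ iteratedCommutator π.ker ⊤ c := by
  induction c generalizing w with
  | zero =>
    change (f w)⁻¹ * w ∈ π.ker
    rw [MonoidHom.mem_ker, map_mul, map_inv, ← MonoidHom.comp_apply, h, inv_mul_cancel]
  | succ c ih =>
    set N := iteratedCommutator π.ker ⊤ (c + 1)
    suffices hs : gammaTerm F (c + 2) ≤
        ((QuotientGroup.mk' N).comp f).eqLocus (QuotientGroup.mk' N) from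
      QuotientGroup.eq.1 (hs hw)
    rw [gammaTerm_succ (by omega), Subgroup.commutator_le]
    intro u hu v _
    change QuotientGroup.mk' N (f ⁅u, v⁆) = QuotientGroup.mk' N ⁅u, v⁆
    have hcomm : ∀ a b : F, ⁅a, b⁆ ∈ N →
        Commute (QuotientGroup.mk' N a) (QuotientGroup.mk' N b) := fun a b hab => by
      rw [← commutatorElement_eq_one_iff_commute, ← map_commutatorElement]
      exact (QuotientGroup.eq_one_iff _).2 hab
    obtain ⟨ρ, hρ, hu'⟩ : ∃ ρ ∈ iteratedCommutator π.ker ⊤ c, u = f u * ρ :=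
      ⟨_, ih hu, (mul_inv_cancel_left _ _).symm⟩
    obtain ⟨σ, hσ, hv'⟩ : ∃ σ ∈ π.ker, v = f v * σ :=
      ⟨(f v)⁻¹ * v, by
        rw [MonoidHom.mem_ker, map_mul, map_inv, ← MonoidHom.comp_apply, h, inv_mul_cancel],
        (mul_inv_cancel_left _ _).symm⟩
    have hρc : ∀ g, Commute (QuotientGroup.mk' N ρ) (QuotientGroup.mk' N g) := fun g =>
      hcomm _ _ (Subgroup.commutator_mem_commutator hρ (Subgroup.mem_top g))
    have hσc : Commute (QuotientGroup.mk' N σ) (QuotientGroup.mk' N u) := (hcomm _ _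
      (commutator_gammaTerm_le_iteratedCommutator π.ker (c + 1)
        (Subgroup.commutator_mem_commutator hu hσ))).symm
    have h1 : ∀ {Q : Type _} [Group Q] {a b p s : Q}, Commute p b → Commute p s →
        Commute p a → Commute s (a * p) → ⁅a * p, b * s⁆ = ⁅a, b⁆ := by
      intro Q _ a b p s hb hs ha hap
      have hsa : Commute s a := by
        have := hap.mul_right (hs.symm.inv_right)
        rwa [mul_inv_cancel_right] at this
      rw [commutatorElement_def, commutatorElement_def, mul_inv_rev, mul_inv_rev]
      calc a * p * (b * s) * (p⁻¹ * a⁻¹) * (s⁻¹ * b⁻¹)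
          = a * (p * (b * s)) * p⁻¹ * a⁻¹ * s⁻¹ * b⁻¹ := by simp only [mul_assoc]
        _ = a * b * (s * a⁻¹) * s⁻¹ * b⁻¹ := by
          rw [(hb.mul_right hs).eq]; simp only [mul_assoc, mul_inv_cancel_left]
        _ = _ := by rw [hsa.inv_right.eq]; simp only [mul_assoc, mul_inv_cancel_left]
    have h2 : QuotientGroup.mk' N u = QuotientGroup.mk' N (f u) * QuotientGroup.mk' N ρ := by
      rw [← map_mul, ← hu']
    have h3 : QuotientGroup.mk' N v = QuotientGroup.mk' N (f v) * QuotientGroup.mk' N σ := by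
      rw [← map_mul, ← hv']
    rw [map_commutatorElement, map_commutatorElement, map_commutatorElement, h2, h3,
      h1 (hρc _) (hρc _) (hρc _) (by rw [← h2]; exact hσc)]

/-- The homomorphism of Baer invariants induced by a homomorphism of presentations. -/
def BaerInvariant.map {π : F →* G} {π' : F' →* G} (c : ℕ) (f : F →* F') (h : π'.comp f = π) :
    BaerInvariant c π →* BaerInvariant c π' :=
  QuotientGroup.map _ _
    ((f.comp (Subgroup.subtype _)).codRestrict (π'.ker ⊓ (⊤ : Subgroup F').lowerCentralSeries c)
      fun x => ⟨map_ker_le h ⟨x, x.2.1, rfl⟩,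
        map_gammaTerm_le f (c + 1) ⟨x, x.2.2, rfl⟩⟩)
    fun x hx => map_iteratedCommutator_le f (map_ker_le h) c
      ⟨x, Subgroup.mem_subgroupOf.1 hx, rfl⟩

theorem BaerInvariant.map_comp_map {π : F →* G} {π' : F' →* G} (c : ℕ) {f : F →* F'}
    {g : F' →* F} (hf : π'.comp f = π) (hg : π.comp g = π') :
    (BaerInvariant.map c g hg).comp (BaerInvariant.map c f hf) = MonoidHom.id _ := by
  apply QuotientGroup.monoidHom_ext
  ext x
  refine QuotientGroup.eq.2 (Subgroup.mem_subgroupOf.2 ?_)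
  have h : π.comp (g.comp f) = π := by rw [← MonoidHom.comp_assoc, hg, hf]
  exact inv_mul_mem_iteratedCommutator_ker h c x.2.2

/-- The Baer invariant does not depend on the free presentation. -/
theorem BaerInvariant.nonempty_mulEquiv [IsFreeGroup F] [IsFreeGroup F'] (c : ℕ) {π : F →* G}
    {π' : F' →* G} (h : Function.Surjective π) (h' : Function.Surjective π') :
    Nonempty (BaerInvariant c π ≃* BaerInvariant c π') := by
  obtain ⟨f, hf⟩ := IsFreeGroup.exists_lift π π' h'
  obtain ⟨g, hg⟩ := IsFreeGroup.exists_lift π' π h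
  exact ⟨MonoidHom.toMulEquiv (BaerInvariant.map c f hf) (BaerInvariant.map c g hg)
    (BaerInvariant.map_comp_map c hf hg) (BaerInvariant.map_comp_map c hg hf)⟩

end Presentation

/-! ### Basic commutators: order, finiteness and factorization of words -/

section BasicCommutators

open FreeMagma

theorem commutatorLT_of_length_lt : ∀ {s t : FreeMagma (Fin 2)}, s.length < t.length →
    commutatorLT s t
  | .of _, .of _, h => absurd h (lt_irrefl _)
  | .of _, .mul _ _, _ => by simp [commutatorLT]
  | .mul a b, .of _, h => by
    have := a.length_pos; have := b.length_pos
    simp only [FreeMagma.length] at h; omega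
  | .mul _ _, .mul _ _, h => by
    simp only [commutatorLT]; exact Or.inl h

theorem commutatorLT_irrefl : ∀ t : FreeMagma (Fin 2), ¬ commutatorLT t t
  | .of _ => by simp [commutatorLT]
  | .mul a b => by simp [commutatorLT, commutatorLT_irrefl a, commutatorLT_irrefl b]

theorem commutatorLT_trans : ∀ {s t u : FreeMagma (Fin 2)}, commutatorLT s t →
    commutatorLT t u → commutatorLT s u
  | .of i, .of j, .of k, h, h' => by
    simp only [commutatorLT] at *; exact h.trans h'
  | .of _, _, .mul _ _, _, _ => by simp [commutatorLT]
  | _, .mul _ _, .of _, _, h' => by simp [commutatorLT] at h'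
  | .mul _ _, .of _, _, h, _ => by simp [commutatorLT] at h
  | .mul a b, .mul c d, .mul e f, h, h' => by
    simp only [commutatorLT] at *
    rcases h with h | ⟨h, h1⟩
    · left; omega
    rcases h' with h' | ⟨h', h2⟩
    · left; omega
    refine Or.inr ⟨h.trans h', ?_⟩
    rcases h1 with h1 | ⟨rfl, h1⟩ <;> rcases h2 with h2 | ⟨rfl, h2⟩
    · exact Or.inl (commutatorLT_trans h1 h2)
    · exact Or.inl h1
    · exact Or.inl h2
    · exact Or.inr ⟨rfl, commutatorLT_trans h1 h2⟩

theorem commutatorLT_trichotomy : ∀ s t : FreeMagma (Fin 2),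
    commutatorLT s t ∨ s = t ∨ commutatorLT t s
  | .of i, .of j => by
    simp only [commutatorLT]
    rcases lt_trichotomy i j with h | rfl | h <;> simp [*]
  | .of _, .mul _ _ => by simp [commutatorLT]
  | .mul _ _, .of _ => by simp [commutatorLT]
  | .mul a b, .mul c d => by
    simp only [commutatorLT]
    rcases lt_trichotomy (a.length + b.length) (c.length + d.length) with h | h | h
    · exact Or.inl (Or.inl h)
    · rcases commutatorLT_trichotomy a c with h1 | rfl | h1
      · exact Or.inl (Or.inr ⟨h, Or.inl h1⟩)
      · rcases commutatorLT_trichotomy b d with h2 | rfl | h2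
        · exact Or.inl (Or.inr ⟨h, Or.inr ⟨rfl, h2⟩⟩)
        · exact Or.inr (Or.inl rfl)
        · exact Or.inr (Or.inr (Or.inr ⟨h.symm, Or.inr ⟨rfl, h2⟩⟩))
      · exact Or.inr (Or.inr (Or.inr ⟨h.symm, Or.inl h1⟩))
    · exact Or.inr (Or.inr (Or.inl h))

/-- The non-strict order on formal commutators. -/
def commutatorLE (s t : FreeMagma (Fin 2)) : Prop := s = t ∨ commutatorLT s t

theorem commutatorLE_trans {s t u : FreeMagma (Fin 2)} (h : commutatorLE s t)
    (h' : commutatorLE t u) : commutatorLE s u := by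
  rcases h with rfl | h
  · exact h'
  rcases h' with rfl | h'
  · exact Or.inr h
  · exact Or.inr (commutatorLT_trans h h')

theorem not_commutatorLT_iff {s t : FreeMagma (Fin 2)} :
    ¬ commutatorLT s t ↔ commutatorLE t s := by
  constructor
  · intro h
    rcases commutatorLT_trichotomy s t with h1 | rfl | h1
    · exact absurd h1 h
    · exact Or.inl rfl
    · exact Or.inr h1
  · rintro (rfl | h) h'
    · exact commutatorLT_irrefl _ h'
    · exact commutatorLT_irrefl _ (commutatorLT_trans h h')

instance : Std.Total commutatorLE :=
  ⟨fun s t => by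
    by_cases h : commutatorLT s t
    · exact Or.inl (Or.inr h)
    · exact Or.inr (not_commutatorLT_iff.1 h)⟩

instance : IsTrans _ commutatorLE := ⟨fun _ _ _ => commutatorLE_trans⟩

theorem finite_setOf_length_le (n : ℕ) : {t : FreeMagma (Fin 2) | t.length ≤ n}.Finite := by
  induction n with
  | zero =>
    convert Set.finite_empty
    ext t
    simpa using t.length_pos.ne'
  | succ n ih =>
    refine ((Set.finite_range (FreeMagma.of : Fin 2 → _)).union
      (ih.image2 (· * ·) ih)).subset ?_
    rintro (i | ⟨a, b⟩) h
    · exact Or.inl ⟨i, rfl⟩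
    · have := a.length_pos; have := b.length_pos
      simp only [Set.mem_ofPred_eq, FreeMagma.length] at h
      exact Or.inr ⟨a, by simp only [Set.mem_ofPred_eq]; omega, b,
        by simp only [Set.mem_ofPred_eq]; omega, rfl⟩

theorem IsBasicCommutator.of_mul {u v : FreeMagma (Fin 2)} (h : IsBasicCommutator (u * v)) :
    IsBasicCommutator u ∧ IsBasicCommutator v ∧ commutatorLT v u ∧
      ∀ a b : FreeMagma (Fin 2), u = a * b → commutatorLE b v := by
  generalize ht : u * v = t at h
  cases h with
  | letter i => cases ht
  | bracket u' v' hu hv hlt hle => cases ht; exact ⟨hu, hv, hlt, hle⟩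

/-- The word spelled by the letters of a formal commutator. -/
def foliage : FreeMagma (Fin 2) → List (Fin 2)
  | .of i => [i]
  | .mul a b => foliage a ++ foliage b

theorem length_foliage : ∀ t : FreeMagma (Fin 2), (foliage t).length = t.length
  | .of _ => rfl
  | .mul a b => by simp [foliage, length_foliage a, length_foliage b]

open Classical in
/-- Insertion of a formal commutator in front of a list: `t` absorbs the head `h` of the list,
becoming `[t, h]`, as long as `h < t`. -/
noncomputable def insertCommutator : FreeMagma (Fin 2) → List (FreeMagma (Fin 2)) →
    List (FreeMagma (Fin 2))
  | t, [] => [t]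
  | t, h :: s => if commutatorLT h t then insertCommutator (t * h) s else t :: h :: s

/-- The factorization of a word into a nondecreasing list of basic commutators, obtained by
inserting the letters one by one, starting from the end of the word. -/
noncomputable def factorWord (w : List (Fin 2)) : List (FreeMagma (Fin 2)) :=
  w.foldr (fun i s => insertCommutator (.of i) s) []

/-- The condition on a basic commutator `t` and a nondecreasing list `s` under which `t` may absorb
the head of `s`: the right component of `t` does not exceed any entry of `s`. -/
def Absorbable (t : FreeMagma (Fin 2)) (s : List (FreeMagma (Fin 2))) : Prop :=
  ∀ a b, t = a * b → ∀ h ∈ s, commutatorLE b h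

/-- A nondecreasing list of basic commutators. -/
def IsSortedBasic (s : List (FreeMagma (Fin 2))) : Prop :=
  s.Pairwise commutatorLE ∧ ∀ t ∈ s, IsBasicCommutator t

theorem isSortedBasic_cons {t : FreeMagma (Fin 2)} {s : List (FreeMagma (Fin 2))} :
    IsSortedBasic (t :: s) ↔
      (∀ h ∈ s, commutatorLE t h) ∧ IsBasicCommutator t ∧ IsSortedBasic s := by
  simp only [IsSortedBasic, List.pairwise_cons, List.mem_cons, forall_eq_or_imp]
  tauto

/-- Inserting the letters of a basic commutator one by one amounts to inserting it as a whole. -/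
theorem foldr_insertCommutator_foliage {t : FreeMagma (Fin 2)} {s : List (FreeMagma (Fin 2))}
    (ht : IsBasicCommutator t) (hs : s.Pairwise commutatorLE) (h : Absorbable t s) :
    (foliage t).foldr (fun i s => insertCommutator (.of i) s) s = insertCommutator t s := by
  induction t generalizing s with
  | ih1 i => rfl
  | ih2 a b iha ihb =>
    obtain ⟨ha, hb, hlt, hle⟩ := ht.of_mul
    have hbs := h a b rfl
    have hb' : (foliage b).foldr (fun i s => insertCommutator (.of i) s) s = b :: s := by
      rw [ihb hb hs]
      · cases s with
        | nil => rfl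
        | cons x s =>
          rw [insertCommutator, if_neg (not_commutatorLT_iff.2 (hbs x List.mem_cons_self))]
      · rintro b₁ b₂ rfl x hx
        refine commutatorLE_trans (Or.inr (commutatorLT_of_length_lt ?_)) (hbs x hx)
        have := b₁.length_pos
        change b₂.length < b₁.length + b₂.length
        omega
    change (foliage a ++ foliage b).foldr _ s = _
    rw [List.foldr_append, hb', iha ha, insertCommutator, if_pos hlt]
    · exact List.pairwise_cons.2 ⟨hbs, hs⟩
    · rintro a₁ a₂ e x hx
      rcases List.mem_cons.1 hx with rfl | hx
      · exact hle _ _ e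
      · exact commutatorLE_trans (hle _ _ e) (hbs x hx)

/-- The factorization of a word into a nondecreasing list of basic commutators is unique. -/
theorem factorWord_flatMap {s : List (FreeMagma (Fin 2))} (hs : IsSortedBasic s) :
    factorWord (s.flatMap foliage) = s := by
  induction s with
  | nil => rfl
  | cons t s ih =>
    obtain ⟨h1, h2, h3⟩ := isSortedBasic_cons.1 hs
    have ih := ih h3
    unfold factorWord at ih ⊢
    rw [List.flatMap_cons, List.foldr_append, ih, foldr_insertCommutator_foliage h2 h3.1]
    · cases s with
      | nil => rfl
      | cons x s =>
        rw [insertCommutator, if_neg (not_commutatorLT_iff.2 (h1 x List.mem_cons_self))]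
    · rintro a b rfl x hx
      refine commutatorLE_trans (Or.inr (commutatorLT_of_length_lt ?_)) (h1 x hx)
      have := a.length_pos
      change b.length < a.length + b.length
      omega

theorem factorWord_foliage {t : FreeMagma (Fin 2)} (ht : IsBasicCommutator t) :
    factorWord (foliage t) = [t] := by
  have h : IsSortedBasic [t] := by simpa [IsSortedBasic] using ht
  simpa using factorWord_flatMap h

end BasicCommutators

/-! ### Basic commutators span the quotients of the lower central series -/

section Spanning

variable {G : Type*} [Group G] (g : Fin 2 → G)

/-- The value of a formal commutator in a group, for given values `g` of the two letters. -/
def groupCommutator : FreeMagma (Fin 2) → G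
  | .of i => g i
  | .mul a b => ⁅groupCommutator a, groupCommutator b⁆

theorem groupCommutator_mem_gammaTerm : ∀ t : FreeMagma (Fin 2),
    groupCommutator g t ∈ gammaTerm G t.length
  | .of _ => Subgroup.mem_top _
  | .mul a b => commutator_mem_gammaTerm (groupCommutator_mem_gammaTerm a)
      (groupCommutator_mem_gammaTerm b) le_rfl

/-- The subgroup generated by the values of the basic commutators of weight `k`, modulo
`γ_(k+1)`. -/
def basicTerm (k : ℕ) : Subgroup G :=
  Subgroup.closure ({x | ∃ t, IsBasicCommutator t ∧ t.length = k ∧ groupCommutator g t = x} ∪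
    gammaTerm G (k + 1))

theorem basicTerm_le_gammaTerm (k : ℕ) : basicTerm g k ≤ gammaTerm G k := by
  rw [basicTerm, Subgroup.closure_le]
  rintro x (⟨t, -, rfl, rfl⟩ | hx)
  · exact groupCommutator_mem_gammaTerm g t
  · exact gammaTerm_antitone (Nat.le_succ k) hx

theorem gammaTerm_succ_le_basicTerm (k : ℕ) : gammaTerm G (k + 1) ≤ basicTerm g k :=
  fun _ hx => Subgroup.subset_closure (Or.inr hx)

variable {g}

theorem groupCommutator_mem_basicTerm {t : FreeMagma (Fin 2)} (ht : IsBasicCommutator t) :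
    groupCommutator g t ∈ basicTerm g t.length :=
  Subgroup.subset_closure (Or.inl ⟨t, ht, rfl, rfl⟩)

theorem mem_basicTerm_of_mk_eq {k : ℕ} {x y : G} (h : (x : G ⧸ gammaTerm G (k + 1)) = y)
    (hy : y ∈ basicTerm g k) : x ∈ basicTerm g k := by
  have := gammaTerm_succ_le_basicTerm g k (QuotientGroup.eq.1 h.symm)
  simpa using mul_mem hy this

theorem commutator_swap_mem {H : Subgroup G} {a b : G} (h : ⁅a, b⁆ ∈ H) : ⁅b, a⁆ ∈ H := by
  rw [← commutatorElement_inv]; exact inv_mem h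

theorem commutator_mem_basicTerm_of_left {i j n : ℕ} (hn : i + j = n) {a b : G}
    (hb : b ∈ gammaTerm G j)
    (h : ∀ t, IsBasicCommutator t → t.length = i → ⁅groupCommutator g t, b⁆ ∈ basicTerm g n)
    (ha : a ∈ basicTerm g i) : ⁅a, b⁆ ∈ basicTerm g n := by
  induction ha using Subgroup.closure_induction with
  | mem x hx =>
    rcases hx with ⟨t, ht, htl, rfl⟩ | hx
    · exact h t ht htl
    · exact gammaTerm_succ_le_basicTerm g n (commutator_mem_gammaTerm hx hb (by omega))
  | one => rw [commutatorElement_one_left]; exact one_mem _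
  | mul x y hx hy ihx ihy =>
    exact mem_basicTerm_of_mk_eq
      (mk_commutator_mul_left (basicTerm_le_gammaTerm g i hy) hb hn) (mul_mem ihx ihy)
  | inv x hx ihx =>
    exact mem_basicTerm_of_mk_eq
      (mk_commutator_inv_left (basicTerm_le_gammaTerm g i hx) hb hn) (inv_mem ihx)

/-- Modulo terms of higher weight, the commutator of two basic commutators is a product of basic
commutators: the collection step. If `[[a, b], v]` violates the last condition in the definition,
the Jacobi identity replaces it by commutators whose smaller entry exceeds `v`. -/
theorem commutator_groupCommutator_mem_basicTerm (n : ℕ) {u v : FreeMagma (Fin 2)}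
    (hu : IsBasicCommutator u) (hv : IsBasicCommutator v) (hn : u.length + v.length = n) :
    ⁅groupCommutator g u, groupCommutator g v⁆ ∈ basicTerm g n := by
  induction n using Nat.strong_induction_on generalizing u v with
  | _ n ihn =>
  -- The inner induction is on the number of formal commutators exceeding the smaller entry.
  have inner : ∀ m : ℕ, ∀ u v : FreeMagma (Fin 2), IsBasicCommutator u → IsBasicCommutator v →
      commutatorLT v u → u.length + v.length = n →
      {t : FreeMagma (Fin 2) | t.length ≤ n ∧ commutatorLT v t}.ncard = m →
      ⁅groupCommutator g u, groupCommutator g v⁆ ∈ basicTerm g n := by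
    intro m
    induction m using Nat.strong_induction_on with
    | _ m ihm =>
    intro u v hu hv hlt hn hm
    have step : ∀ u' v' : FreeMagma (Fin 2), IsBasicCommutator u' → IsBasicCommutator v' →
        commutatorLT v u' → commutatorLT v v' → u'.length + v'.length = n →
        ⁅groupCommutator g u', groupCommutator g v'⁆ ∈ basicTerm g n := by
      have card_lt : ∀ w : FreeMagma (Fin 2), commutatorLT v w → w.length ≤ n →
          {t : FreeMagma (Fin 2) | t.length ≤ n ∧ commutatorLT w t}.ncard < m := by
        intro w hvw hwn
        rw [← hm]
        refine Set.ncard_lt_ncard ?_ ((finite_setOf_length_le n).subset fun t ht => ht.1)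
        refine Set.ssubset_iff_of_subset ?_ |>.2 ⟨w, ⟨hwn, hvw⟩, ?_⟩
        · exact fun t ht => ⟨ht.1, commutatorLT_trans hvw ht.2⟩
        · exact fun ht => commutatorLT_irrefl w ht.2
      intro u' v' hu' hv' h1 h2 hn'
      rcases commutatorLT_trichotomy u' v' with h | rfl | h
      · exact commutator_swap_mem
          (ihm _ (card_lt u' h1 (by omega)) v' u' hv' hu' h (by omega) rfl)
      · rw [commutatorElement_self]; exact one_mem _
      · exact ihm _ (card_lt v' h2 (by omega)) u' v' hu' hv' h hn' rfl
    by_cases hle : ∀ a b : FreeMagma (Fin 2), u = a * b → b = v ∨ commutatorLT b v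
    · have h := groupCommutator_mem_basicTerm (g := g) (.bracket u v hu hv hlt hle)
      rwa [show (u * v).length = n from hn] at h
    · push Not at hle
      obtain ⟨a, b, rfl, hne, hnlt⟩ := hle
      have hvb : commutatorLT v b := by
        rcases commutatorLT_trichotomy v b with h | h | h
        · exact h
        · exact absurd h.symm hne
        · exact absurd h hnlt
      obtain ⟨ha, hb, hba, -⟩ := hu.of_mul
      have hva := commutatorLT_trans hvb hba
      have hla : (a * b).length = a.length + b.length := rfl
      have pa := a.length_pos
      have pb := b.length_pos
      have pv := v.length_pos
      refine mem_basicTerm_of_mk_eq (mk_commutator_jacobi (groupCommutator_mem_gammaTerm g a)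
        (groupCommutator_mem_gammaTerm g b) (groupCommutator_mem_gammaTerm g v) (by omega))
        (mul_mem ?_ ?_)
      · refine commutator_mem_basicTerm_of_left (i := a.length + v.length) (by omega)
          (groupCommutator_mem_gammaTerm g b) (fun t ht htl => ?_)
          (ihn _ (by omega) ha hv rfl)
        exact step t b ht hb (commutatorLT_of_length_lt (by omega)) hvb (by omega)
      · refine commutator_swap_mem (commutator_mem_basicTerm_of_left
          (i := b.length + v.length) (by omega)
          (groupCommutator_mem_gammaTerm g a) (fun t ht htl => ?_)
          (ihn _ (by omega) hb hv rfl))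
        exact step t a ht ha (commutatorLT_of_length_lt (by omega)) hva (by omega)
  rcases commutatorLT_trichotomy u v with h | rfl | h
  · exact commutator_swap_mem (inner _ v u hv hu h (by omega) rfl)
  · rw [commutatorElement_self]; exact one_mem _
  · exact inner _ u v hu hv h hn rfl

theorem commutator_mem_basicTerm {i j n : ℕ} (hn : i + j = n) {a b : G}
    (ha : a ∈ basicTerm g i) (hb : b ∈ basicTerm g j) : ⁅a, b⁆ ∈ basicTerm g n := by
  refine commutator_mem_basicTerm_of_left hn (basicTerm_le_gammaTerm g j hb)
    (fun t ht hti => ?_) ha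
  refine commutator_swap_mem (commutator_mem_basicTerm_of_left (by omega)
    (hti ▸ groupCommutator_mem_gammaTerm g t) (fun s hs hsj => ?_) hb)
  exact commutator_groupCommutator_mem_basicTerm n hs ht (by omega)

/-- The basic commutators of weight `k` in two generators span `γ_k` modulo `γ_(k+1)`. -/
theorem basicTerm_eq_gammaTerm (hg : Subgroup.closure (Set.range g) = ⊤) {k : ℕ} (hk : 1 ≤ k) :
    basicTerm g k = gammaTerm G k := by
  refine le_antisymm (basicTerm_le_gammaTerm g k) ?_
  have h1 : basicTerm g 1 = ⊤ := by
    rw [eq_top_iff, ← hg, Subgroup.closure_le]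
    rintro _ ⟨i, rfl⟩
    exact groupCommutator_mem_basicTerm (g := g) (t := .of i) (.letter i)
  induction k, hk using Nat.le_induction with
  | base => exact h1.ge
  | succ k hk ih =>
    rw [gammaTerm_succ hk, Subgroup.commutator_le]
    intro a ha b _
    exact commutator_mem_basicTerm rfl (ih ha) (h1.symm ▸ Subgroup.mem_top b)

end Spanning

/-! ### The Magnus representation -/

section Magnus

open PowerSeries

variable {A : Type*} [Ring A]

/-- The ideal `X ^ k * (d, X ^ n)` of the power series ring. For `d = 1` it is the ideal generated
by `X ^ k`. -/
def truncationIdeal (A : Type*) [Ring A] (d n k : ℕ) : AddSubgroup A⟦X⟧ where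
  carrier := {P | ∃ a b : A⟦X⟧, P = X ^ k * (d • a + X ^ n * b)}
  zero_mem' := ⟨0, 0, by simp⟩
  add_mem' := by
    rintro _ _ ⟨a, b, rfl⟩ ⟨a', b', rfl⟩
    exact ⟨a + a', b + b', by rw [← mul_add, smul_add, mul_add (X ^ n)]; abel_nf⟩
  neg_mem' := by
    rintro _ ⟨a, b, rfl⟩
    exact ⟨-a, -b, by rw [← mul_neg, smul_neg, mul_neg (X ^ n), neg_add]⟩

theorem mem_truncationIdeal_one {n k : ℕ} {P : A⟦X⟧} :
    P ∈ truncationIdeal A 1 n k ↔ ∃ a : A⟦X⟧, P = X ^ k * a := by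
  constructor
  · rintro ⟨a, b, h⟩; exact ⟨_, h⟩
  · rintro ⟨a, h⟩; exact ⟨a, 0, by simpa using h⟩

theorem mul_mem_truncationIdeal_right {d n k : ℕ} {P : A⟦X⟧} (hP : P ∈ truncationIdeal A d n k)
    (Q : A⟦X⟧) : P * Q ∈ truncationIdeal A d n k := by
  obtain ⟨a, b, rfl⟩ := hP
  exact ⟨a * Q, b * Q, by rw [mul_assoc, add_mul, smul_mul_assoc, mul_assoc]⟩

theorem mul_mem_truncationIdeal_left {d n k : ℕ} {P : A⟦X⟧} (hP : P ∈ truncationIdeal A d n k)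
    (Q : A⟦X⟧) : Q * P ∈ truncationIdeal A d n k := by
  obtain ⟨a, b, rfl⟩ := hP
  exact ⟨Q * a, Q * b, by
    rw [← mul_assoc, ← X_pow_mul, mul_assoc, mul_add, mul_smul_comm, ← mul_assoc Q, ← X_pow_mul,
      mul_assoc]⟩

theorem X_pow_mul_mem_truncationIdeal {d n k : ℕ} {P : A⟦X⟧} (hP : P ∈ truncationIdeal A d n k)
    (j : ℕ) : X ^ j * P ∈ truncationIdeal A d n (k + j) := by
  obtain ⟨a, b, rfl⟩ := hP
  exact ⟨a, b, by rw [← mul_assoc, ← pow_add, add_comm j]⟩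

theorem truncationIdeal_antitone (d n : ℕ) : Antitone (truncationIdeal A d n) := by
  rintro k l h _ ⟨a, b, rfl⟩
  refine ⟨X ^ (l - k) * a, X ^ (l - k) * b, ?_⟩
  rw [← Nat.add_sub_cancel' h, pow_add, Nat.add_sub_cancel_left, mul_assoc, mul_add,
    mul_smul_comm, ← mul_assoc (X ^ n), ← mul_assoc (X ^ (l - k)), ← pow_add, ← pow_add,
    add_comm n]

theorem X_pow_mem_truncationIdeal (d n k : ℕ) (P : A⟦X⟧) :
    X ^ (k + n) * P ∈ truncationIdeal A d n k :=
  ⟨0, P, by rw [smul_zero, zero_add, ← mul_assoc, pow_add]⟩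

theorem smul_mem_truncationIdeal (d n k : ℕ) (P : A⟦X⟧) :
    d • (X ^ k * P) ∈ truncationIdeal A d n k :=
  ⟨P, 0, by rw [mul_zero, add_zero, mul_smul_comm]⟩

theorem coeff_of_mem_truncationIdeal {d n k j : ℕ} {P : A⟦X⟧}
    (hP : P ∈ truncationIdeal A d n k) (hj : j < k + n) : ∃ a : A, coeff j P = d • a := by
  obtain ⟨a, b, rfl⟩ := hP
  refine ⟨coeff j (X ^ k * a), ?_⟩
  rw [mul_add, map_add, ← mul_assoc (X ^ k), ← pow_add, coeff_X_pow_mul' _ (k + n),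
    if_neg (by omega), add_zero, mul_smul_comm, map_nsmul]

/-- The units congruent to `1` modulo `truncationIdeal A d n k`. -/
def congruenceUnits (A : Type*) [Ring A] (d n k : ℕ) : Subgroup A⟦X⟧ˣ where
  carrier := {u | (u : A⟦X⟧) - 1 ∈ truncationIdeal A d n k}
  one_mem' := by simp [zero_mem]
  mul_mem' {u v} hu hv := by
    have e : ((u * v : A⟦X⟧ˣ) : A⟦X⟧) - 1 = ((u : A⟦X⟧) - 1) * v + ((v : A⟦X⟧) - 1) := by
      rw [Units.val_mul, sub_mul, one_mul]; abel
    simp only [Set.mem_ofPred_eq] at *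
    rw [e]
    exact add_mem (mul_mem_truncationIdeal_right hu _) hv
  inv_mem' {u} hu := by
    have e : ((u⁻¹ : A⟦X⟧ˣ) : A⟦X⟧) - 1 = -((u⁻¹ : A⟦X⟧ˣ) * ((u : A⟦X⟧) - 1)) := by
      rw [mul_sub, Units.inv_mul, mul_one]; abel
    simp only [Set.mem_ofPred_eq] at *
    rw [e]
    exact neg_mem (mul_mem_truncationIdeal_left hu _)

theorem mem_congruenceUnits {d n k : ℕ} {u : A⟦X⟧ˣ} :
    u ∈ congruenceUnits A d n k ↔ (u : A⟦X⟧) - 1 ∈ truncationIdeal A d n k := Iff.rfl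

theorem mem_congruenceUnits_one {n k : ℕ} {u : A⟦X⟧ˣ} :
    u ∈ congruenceUnits A 1 n k ↔ ∃ P : A⟦X⟧, (u : A⟦X⟧) = 1 + X ^ k * P := by
  rw [mem_congruenceUnits, mem_truncationIdeal_one]
  simp only [sub_eq_iff_eq_add']

theorem congruenceUnits_antitone (d n : ℕ) : Antitone (congruenceUnits A d n) :=
  fun _ _ h _ hu => truncationIdeal_antitone d n h hu

instance congruenceUnits_normal (d n k : ℕ) : (congruenceUnits A d n k).Normal where
  conj_mem u hu v := by
    have e : ((v * u * v⁻¹ : A⟦X⟧ˣ) : A⟦X⟧) - 1 = v * ((u : A⟦X⟧) - 1) * (v⁻¹ : A⟦X⟧ˣ) := by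
      rw [mul_sub, sub_mul, mul_one, Units.mul_inv]; simp
    rw [mem_congruenceUnits, e]
    exact mul_mem_truncationIdeal_right (mul_mem_truncationIdeal_left hu _) _

theorem coe_commutator_units (u v : A⟦X⟧ˣ) : ((⁅u, v⁆ : A⟦X⟧ˣ) : A⟦X⟧) =
    1 + (((u : A⟦X⟧) - 1) * ((v : A⟦X⟧) - 1) - ((v : A⟦X⟧) - 1) * ((u : A⟦X⟧) - 1)) *
      ((u⁻¹ * v⁻¹ : A⟦X⟧ˣ) : A⟦X⟧) := by
  have h1 : ((v * u : A⟦X⟧ˣ) : A⟦X⟧) * ((u⁻¹ * v⁻¹ : A⟦X⟧ˣ) : A⟦X⟧) = 1 := by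
    rw [← Units.val_mul]; simp
  have h2 : ((⁅u, v⁆ : A⟦X⟧ˣ) : A⟦X⟧) =
      ((u * v : A⟦X⟧ˣ) : A⟦X⟧) * ((u⁻¹ * v⁻¹ : A⟦X⟧ˣ) : A⟦X⟧) := by
    rw [← Units.val_mul, commutatorElement_def]; simp [mul_assoc]
  have h3 : ((u : A⟦X⟧) - 1) * ((v : A⟦X⟧) - 1) - ((v : A⟦X⟧) - 1) * ((u : A⟦X⟧) - 1) =
      ((u * v : A⟦X⟧ˣ) : A⟦X⟧) - ((v * u : A⟦X⟧ˣ) : A⟦X⟧) := by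
    rw [Units.val_mul, Units.val_mul]; noncomm_ring
  rw [h3, sub_mul, h1, h2]; abel

theorem commutator_mem_congruenceUnits {d n k : ℕ} {u v : A⟦X⟧ˣ}
    (hu : u ∈ congruenceUnits A d n k) (hv : v ∈ congruenceUnits A 1 0 1) :
    ⁅u, v⁆ ∈ congruenceUnits A d n (k + 1) := by
  obtain ⟨Q, hQ⟩ := mem_congruenceUnits_one.1 hv
  rw [mem_congruenceUnits, coe_commutator_units, add_sub_cancel_left]
  apply mul_mem_truncationIdeal_right
  rw [hQ, add_sub_cancel_left]
  apply sub_mem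
  · rw [← mul_assoc, ← X_pow_mul, mul_assoc]
    exact X_pow_mul_mem_truncationIdeal (mul_mem_truncationIdeal_right hu Q) 1
  · rw [mul_assoc]
    exact X_pow_mul_mem_truncationIdeal (mul_mem_truncationIdeal_left hu Q) 1

/-- The unit `1 + a X`. -/
noncomputable def oneAddX (a : A) : A⟦X⟧ˣ where
  val := 1 + X * C a
  inv := invOfUnit (1 + X * C a) 1
  val_inv := mul_invOfUnit _ _ (by simp)
  inv_val := invOfUnit_mul _ _ (by simp)

theorem oneAddX_pow_mem_congruenceUnits (a : A) {d n r : ℕ}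
    (h : ∀ i, 1 ≤ i → i ≤ n → d ∣ r.choose i) : oneAddX a ^ r ∈ congruenceUnits A d n 1 := by
  rw [mem_congruenceUnits, Units.val_pow_eq_pow_val]
  change (1 + X * C a) ^ r - 1 ∈ _
  rw [add_comm, (Commute.one_right _).add_pow, Finset.sum_range_succ', add_sub_assoc]
  simp only [one_pow, mul_one, pow_zero, Nat.choose_zero_right, Nat.cast_one, sub_self, add_zero]
  refine sum_mem fun i _ => ?_
  have e : (X * C a) ^ (i + 1) * ((r.choose (i + 1) : ℕ) : A⟦X⟧) =
      r.choose (i + 1) • (X ^ (i + 1) * C a ^ (i + 1)) := by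
    rw [nsmul_eq_mul', ((commute_X (C a)).symm).mul_pow]
  rw [e]
  rcases lt_or_ge i n with hi | hi
  · obtain ⟨m, hm⟩ := h (i + 1) (by omega) (by omega)
    rw [hm, mul_smul]
    refine truncationIdeal_antitone d n (by omega : 1 ≤ i + 1) ?_
    rw [← mul_smul_comm m]
    exact smul_mem_truncationIdeal _ _ _ _
  · refine nsmul_mem (truncationIdeal_antitone d n (by omega : 1 ≤ i + 1 - n) ?_) _
    have := X_pow_mem_truncationIdeal d n (i + 1 - n) (C a ^ (i + 1))
    rwa [Nat.sub_add_cancel (by omega)] at this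

variable (x : Fin 2 → A)

/-- The Magnus representation of the free group: the letter `i` is sent to `1 + x_i X`. -/
noncomputable def magnus : FreeGroup (Fin 2) →* A⟦X⟧ˣ := FreeGroup.lift fun i => oneAddX (x i)

theorem magnus_of (i : Fin 2) : magnus x (FreeGroup.of i) = oneAddX (x i) :=
  FreeGroup.lift_apply_of

theorem oneAddX_mem (a : A) : oneAddX a ∈ congruenceUnits A 1 0 1 :=
  mem_congruenceUnits_one.2 ⟨C a, by rw [pow_one]; rfl⟩

theorem magnus_mem (w : FreeGroup (Fin 2)) : magnus x w ∈ congruenceUnits A 1 0 1 := by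
  induction w using FreeGroup.induction_on with
  | C1 => rw [map_one]; exact one_mem _
  | of i => rw [magnus_of]; exact oneAddX_mem _
  | inv_of i ih => rw [map_inv]; exact inv_mem ih
  | mul u v hu hv => rw [map_mul]; exact mul_mem hu hv

theorem iteratedCommutator_le_comap_congruenceUnits {H : Subgroup (FreeGroup (Fin 2))}
    {d n : ℕ} {k : ℕ} (h : H ≤ (congruenceUnits A d n k).comap (magnus x)) (j : ℕ) :
    iteratedCommutator H ⊤ j ≤ (congruenceUnits A d n (k + j)).comap (magnus x) := by
  induction j with
  | zero => exact h
  | succ j ih =>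
    rw [iteratedCommutator, Subgroup.commutator_le]
    intro u hu v _
    rw [Subgroup.mem_comap, map_commutatorElement]
    exact commutator_mem_congruenceUnits (ih hu) (magnus_mem x v)

theorem magnus_mem_of_mem_gammaTerm {k : ℕ} {w : FreeGroup (Fin 2)}
    (hw : w ∈ gammaTerm (FreeGroup (Fin 2)) k) : magnus x w ∈ congruenceUnits A 1 0 k := by
  rcases Nat.eq_zero_or_pos k with rfl | hk
  · exact congruenceUnits_antitone 1 0 zero_le_one (magnus_mem x w)
  obtain ⟨k, rfl⟩ := Nat.exists_eq_add_of_le hk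
  rw [← iteratedCommutator_gammaTerm le_rfl] at hw
  exact iteratedCommutator_le_comap_congruenceUnits x (fun w _ => magnus_mem x w) k hw

theorem coeff_magnus_of_lt {k j : ℕ} {w : FreeGroup (Fin 2)}
    (hw : w ∈ gammaTerm (FreeGroup (Fin 2)) k) (hj : 1 ≤ j) (hjk : j < k) :
    coeff j (magnus x w : A⟦X⟧) = 0 := by
  obtain ⟨P, hP⟩ := mem_congruenceUnits_one.1 (magnus_mem_of_mem_gammaTerm x hw)
  rw [hP, map_add, coeff_X_pow_mul', if_neg (by omega), coeff_one, if_neg (by omega), add_zero]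

/-- On `γ_m`, the Magnus coefficients of degree less than `2 m` are additive. -/
theorem coeff_magnus_mul {m j : ℕ} (hj : 1 ≤ j) (hjm : j < 2 * m) {u v : FreeGroup (Fin 2)}
    (hu : u ∈ gammaTerm (FreeGroup (Fin 2)) m) (hv : v ∈ gammaTerm (FreeGroup (Fin 2)) m) :
    coeff j (magnus x (u * v) : A⟦X⟧) =
      coeff j (magnus x u : A⟦X⟧) + coeff j (magnus x v : A⟦X⟧) := by
  obtain ⟨P, hP⟩ := mem_congruenceUnits_one.1 (magnus_mem_of_mem_gammaTerm x hu)
  obtain ⟨Q, hQ⟩ := mem_congruenceUnits_one.1 (magnus_mem_of_mem_gammaTerm x hv)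
  have e : (1 + X ^ m * P) * (1 + X ^ m * Q) =
      (1 + X ^ m * P) + (1 + X ^ m * Q) - 1 + X ^ (2 * m) * (P * Q) := by
    have : X ^ m * P * (X ^ m * Q) = X ^ (2 * m) * (P * Q) := by
      rw [mul_assoc, ← mul_assoc P, ← X_pow_mul, mul_assoc, ← mul_assoc, two_mul, pow_add]
    rw [mul_add, add_mul, add_mul, this]; noncomm_ring
  rw [map_mul, Units.val_mul, hP, hQ, e, map_add, map_sub, map_add, coeff_one,
    if_neg (by omega), sub_zero, coeff_X_pow_mul', if_neg (by omega), add_zero]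

/-- The Magnus coefficient of degree `j`, as a homomorphism from `γ_m` to the additive group of
the coefficient ring, for `1 ≤ j < 2 m`. -/
noncomputable def magnusCoeff {m j : ℕ} (hj : 1 ≤ j) (hjm : j < 2 * m) :
    gammaTerm (FreeGroup (Fin 2)) m →* Multiplicative A where
  toFun w := Multiplicative.ofAdd (coeff j (magnus x w : A⟦X⟧))
  map_one' := by
    rw [OneMemClass.coe_one, map_one, Units.val_one, coeff_one, if_neg (by omega)]; rfl
  map_mul' u v := by
    rw [Subgroup.coe_mul, coeff_magnus_mul x hj hjm u.2 v.2]; rfl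

/-- The value of a formal commutator in a ring, where `[a, b] = a b - b a`, for given values `x`
of the two letters. -/
def ringCommutator : FreeMagma (Fin 2) → A
  | .of i => x i
  | .mul a b => ringCommutator a * ringCommutator b - ringCommutator b * ringCommutator a

theorem ringCommutator_mul (a b : FreeMagma (Fin 2)) : ringCommutator x (a * b) =
    ringCommutator x a * ringCommutator x b - ringCommutator x b * ringCommutator x a := rfl

theorem constantCoeff_of_mem {n : ℕ} {u : A⟦X⟧ˣ} (hu : u ∈ congruenceUnits A 1 n 1) :
    constantCoeff (u : A⟦X⟧) = 1 := by
  obtain ⟨P, hP⟩ := mem_congruenceUnits_one.1 hu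
  rw [hP]; simp

/-- The leading term of the Magnus expansion of a group commutator is the ring commutator. -/
theorem exists_magnus_groupCommutator : ∀ t : FreeMagma (Fin 2), ∃ P : A⟦X⟧,
    (magnus x (groupCommutator FreeGroup.of t) : A⟦X⟧) = 1 + X ^ t.length * P ∧
      constantCoeff P = ringCommutator x t
  | .of i => ⟨C (x i), by
      rw [groupCommutator, magnus_of, FreeMagma.length, pow_one]; rfl, by
      rw [constantCoeff_C]; rfl⟩
  | .mul a b => by
    obtain ⟨P, hP, hP0⟩ := exists_magnus_groupCommutator a
    obtain ⟨Q, hQ, hQ0⟩ := exists_magnus_groupCommutator b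
    set u := magnus x (groupCommutator FreeGroup.of a) with hu
    set v := magnus x (groupCommutator FreeGroup.of b) with hv
    refine ⟨(P * Q - Q * P) * ((u⁻¹ * v⁻¹ : A⟦X⟧ˣ) : A⟦X⟧), ?_, ?_⟩
    · rw [groupCommutator, map_commutatorElement, ← hu, ← hv, coe_commutator_units, hP, hQ,
        add_sub_cancel_left, add_sub_cancel_left]
      have e : ∀ (i j : ℕ) (P Q : A⟦X⟧), X ^ i * P * (X ^ j * Q) = X ^ (i + j) * (P * Q) := by
        intro i j P Q
        rw [mul_assoc, ← mul_assoc P, ← X_pow_mul, mul_assoc, ← mul_assoc, pow_add]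
      rw [e, e, add_comm b.length, ← mul_sub, mul_assoc]
      rfl
    · have h1 : u⁻¹ * v⁻¹ ∈ congruenceUnits A 1 0 1 := by
        rw [hu, hv, ← map_inv, ← map_inv, ← map_mul]; exact magnus_mem x _
      rw [map_mul, constantCoeff_of_mem h1, mul_one, map_sub, map_mul, map_mul, hP0, hQ0]
      rfl

theorem coeff_magnus_groupCommutator (t : FreeMagma (Fin 2)) :
    coeff t.length (magnus x (groupCommutator FreeGroup.of t) : A⟦X⟧) = ringCommutator x t := by
  obtain ⟨P, hP, hP0⟩ := exists_magnus_groupCommutator x t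
  rw [hP, map_add, coeff_one, if_neg t.length_pos.ne', zero_add, coeff_X_pow_mul', if_pos le_rfl,
    Nat.sub_self, coeff_zero_eq_constantCoeff_apply, hP0]

/-- In any ring, the commutator of two basic commutators is an integral combination of basic
commutators of the same weight. -/
theorem ringCommutator_mul_mem_span (R : Type*) [CommRing R] [Algebra R A]
    {u v : FreeMagma (Fin 2)} (hu : IsBasicCommutator u)
    (hv : IsBasicCommutator v) : ringCommutator x (u * v) ∈ Submodule.span R
      (ringCommutator x '' {t | IsBasicCommutator t ∧ t.length = u.length + v.length}) := by
  set n := u.length + v.length with hn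
  have hn1 : 1 ≤ n := by have := u.length_pos; omega
  have h := commutator_groupCommutator_mem_basicTerm (g := FreeGroup.of) n hu hv rfl
  rw [← coeff_magnus_groupCommutator]
  change coeff n (magnus x ⁅groupCommutator FreeGroup.of u, groupCommutator FreeGroup.of v⁆ : A⟦X⟧)
    ∈ _
  generalize ⁅groupCommutator FreeGroup.of u, groupCommutator FreeGroup.of v⁆ = w at h ⊢
  induction h using Subgroup.closure_induction with
  | mem w hw =>
    rcases hw with ⟨t, ht, htn, rfl⟩ | hw
    · rw [← htn, coeff_magnus_groupCommutator]
      exact Submodule.subset_span ⟨t, ⟨ht, rfl⟩, rfl⟩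
    · rw [coeff_magnus_of_lt x hw hn1 (Nat.lt_succ_self n)]; exact zero_mem _
  | one =>
    rw [map_one, Units.val_one, coeff_one, if_neg (by omega)]; exact zero_mem _
  | mul a b ha hb iha ihb =>
    rw [coeff_magnus_mul x hn1 (by omega) (basicTerm_le_gammaTerm _ n ha)
      (basicTerm_le_gammaTerm _ n hb)]
    exact add_mem iha ihb
  | inv a ha iha =>
    have e := coeff_magnus_mul x hn1 (by omega) (basicTerm_le_gammaTerm _ n ha)
      (inv_mem (basicTerm_le_gammaTerm _ n ha))
    rw [mul_inv_cancel, map_one, Units.val_one, coeff_one, if_neg (by omega), eq_comm] at e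
    rw [eq_neg_of_add_eq_zero_right e]
    exact neg_mem iha

end Magnus

/-! ### Products of basic commutators in the free associative algebra -/

section PBW

variable {R A : Type*} [CommRing R] [Ring A] [Algebra R A] (x : Fin 2 → A)

/-- The product of the values of a list of formal commutators in a ring. -/
def ringCommutatorProd (s : List (FreeMagma (Fin 2))) : A := (s.map (ringCommutator x)).prod

/-- The total number of letters in a list of formal commutators. -/
def totalLength (s : List (FreeMagma (Fin 2))) : ℕ := (s.map FreeMagma.length).sum

theorem length_flatMap_foliage (s : List (FreeMagma (Fin 2))) :
    (s.flatMap foliage).length = totalLength s := by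
  rw [List.length_flatMap, totalLength]
  simp only [length_foliage]

theorem ringCommutatorProd_cons (t : FreeMagma (Fin 2)) (s : List (FreeMagma (Fin 2))) :
    ringCommutatorProd x (t :: s) = ringCommutator x t * ringCommutatorProd x s := by
  simp [ringCommutatorProd]

theorem totalLength_cons (t : FreeMagma (Fin 2)) (s : List (FreeMagma (Fin 2))) :
    totalLength (t :: s) = t.length + totalLength s := by
  simp [totalLength]

variable (R) in
/-- Permuting a product of basic commutators changes it by a combination of products with fewer
factors and the same total weight. -/
theorem ringCommutatorProd_sub_mem_span {s s' : List (FreeMagma (Fin 2))} (h : s.Perm s')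
    (hs : ∀ t ∈ s, IsBasicCommutator t) :
    ringCommutatorProd x s - ringCommutatorProd x s' ∈ Submodule.span R (ringCommutatorProd x ''
      {k | (∀ t ∈ k, IsBasicCommutator t) ∧ totalLength k = totalLength s ∧
        k.length < s.length}) := by
  induction h with
  | nil => rw [sub_self]; exact zero_mem _
  | cons a h ih =>
    rename_i l l'
    have ih := ih fun t ht => hs t (List.mem_cons_of_mem _ ht)
    have := Submodule.mem_map_of_mem (f := LinearMap.mulLeft R (ringCommutator x a)) ih
    rw [LinearMap.mulLeft_apply, mul_sub, ← ringCommutatorProd_cons,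
      ← ringCommutatorProd_cons, Submodule.map_span] at this
    refine Submodule.span_mono ?_ this
    rintro _ ⟨_, ⟨k, ⟨hk, hkl, hkn⟩, rfl⟩, rfl⟩
    refine ⟨a :: k, ⟨?_, ?_, ?_⟩, ?_⟩
    · rintro t (_ | ⟨_, ht⟩)
      · exact hs _ List.mem_cons_self
      · exact hk t ht
    · rw [totalLength_cons, totalLength_cons, hkl]
    · simpa using hkn
    · rw [LinearMap.mulLeft_apply, ringCommutatorProd_cons]
  | swap a b l =>
    have ha := hs a (List.mem_cons_of_mem _ List.mem_cons_self)
    have hb := hs b List.mem_cons_self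
    have := Submodule.mem_map_of_mem (f := LinearMap.mulRight R (ringCommutatorProd x l))
      (ringCommutator_mul_mem_span x R hb ha)
    rw [LinearMap.mulRight_apply, ringCommutator_mul, Submodule.map_span, sub_mul, mul_assoc,
      mul_assoc] at this
    simp only [ringCommutatorProd_cons]
    refine Submodule.span_mono ?_ this
    rintro _ ⟨_, ⟨t, ⟨ht, htl⟩, rfl⟩, rfl⟩
    refine ⟨t :: l, ⟨?_, ?_, ?_⟩, ?_⟩
    · rintro u (_ | ⟨_, hu⟩)
      · exact ht
      · exact hs u (List.mem_cons_of_mem _ (List.mem_cons_of_mem _ hu))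
    · simp only [totalLength_cons, htl]; omega
    · simp
    · rw [LinearMap.mulRight_apply, ringCommutatorProd_cons]
  | trans h h' ih ih' =>
    rename_i l l' l''
    have h1 := ih hs
    have h2 := ih' fun t ht => hs t (h.mem_iff.2 ht)
    have e : totalLength l' = totalLength l := ((h.map _).sum_eq).symm
    rw [e, ← h.length_eq] at h2
    simpa using add_mem h1 h2

variable (R) in
/-- Every product of basic commutators is a combination of nondecreasing ones. -/
theorem ringCommutatorProd_mem_span_sorted {s : List (FreeMagma (Fin 2))}
    (hs : ∀ t ∈ s, IsBasicCommutator t) :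
    ringCommutatorProd x s ∈ Submodule.span R (ringCommutatorProd x ''
      {k | IsSortedBasic k ∧ totalLength k = totalLength s}) := by
  classical
  induction hn : s.length using Nat.strong_induction_on generalizing s with
  | _ n ih =>
  have hp := List.perm_insertionSort commutatorLE s
  have h1 : ringCommutatorProd x (s.insertionSort commutatorLE) ∈ Submodule.span R
      (ringCommutatorProd x '' {k | IsSortedBasic k ∧ totalLength k = totalLength s}) :=
    Submodule.subset_span ⟨_, ⟨⟨List.pairwise_insertionSort _ s,
      fun t ht => hs t (hp.mem_iff.1 ht)⟩, (hp.map _).sum_eq⟩, rfl⟩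
  have h2 := ringCommutatorProd_sub_mem_span R x hp.symm hs
  have h3 := Submodule.span_le (p := Submodule.span R (ringCommutatorProd x ''
    {k | IsSortedBasic k ∧ totalLength k = totalLength s})).2 ?_ h2
  · have := add_mem h3 h1
    rwa [sub_add_cancel] at this
  · rintro _ ⟨k, ⟨hk, hkl, hkn⟩, rfl⟩
    rw [← hkl]
    exact ih _ (hn ▸ hkn) hk rfl

end PBW

section FreeAlgebra

open FreeAlgebra

theorem basisFreeMonoid_apply (R : Type*) [CommRing R] (w : List (Fin 2)) :
    basisFreeMonoid R (Fin 2) (FreeMonoid.ofList w) =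
      ringCommutatorProd (ι R) (w.map FreeMagma.of) := by
  rw [basisFreeMonoid, Module.Basis.map_apply, Finsupp.coe_basisSingleOne]
  change MonoidAlgebra.lift R (FreeAlgebra R (Fin 2)) (FreeMonoid (Fin 2)) (FreeMonoid.lift (ι R))
    (MonoidAlgebra.single (FreeMonoid.ofList w) 1) = _
  rw [MonoidAlgebra.lift_single, one_smul, FreeMonoid.lift_apply, FreeMonoid.toList_ofList,
    ringCommutatorProd, List.map_map]
  rfl

/-- The linear endomorphism of the free algebra that sends a word to the product of the basic
commutators in its factorization. -/
noncomputable def factorizationMap (R : Type*) [CommRing R] :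
    FreeAlgebra R (Fin 2) →ₗ[R] FreeAlgebra R (Fin 2) :=
  (basisFreeMonoid R (Fin 2)).constr R fun w =>
    ringCommutatorProd (ι R) (factorWord w.toList)

theorem factorizationMap_basis (R : Type*) [CommRing R] (w : List (Fin 2)) :
    factorizationMap R (basisFreeMonoid R (Fin 2) (FreeMonoid.ofList w)) =
      ringCommutatorProd (ι R) (factorWord w) :=
  (basisFreeMonoid R (Fin 2)).constr_basis R _ _

/-- The span of the words of length at most `m`. -/
def wordSpan (R : Type*) [CommRing R] (m : ℕ) : Submodule R (FreeAlgebra R (Fin 2)) :=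
  Submodule.span R ((fun w => basisFreeMonoid R (Fin 2) (FreeMonoid.ofList w)) ''
    {w : List (Fin 2) | w.length ≤ m})

theorem wordSpan_fg (R : Type*) [CommRing R] (m : ℕ) : (wordSpan R m).FG :=
  Submodule.fg_span ((List.finite_length_le (Fin 2) m).image _)

theorem wordSpan_mono (R : Type*) [CommRing R] : Monotone (wordSpan R) := fun _ _ h =>
  Submodule.span_mono (Set.image_mono fun _ hw => le_trans hw h)

theorem exists_mem_wordSpan (R : Type*) [CommRing R] (a : FreeAlgebra R (Fin 2)) :
    ∃ m, a ∈ wordSpan R m := by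
  have ha : a ∈ Submodule.span R (Set.range (basisFreeMonoid R (Fin 2))) := by
    rw [(basisFreeMonoid R (Fin 2)).span_eq]; trivial
  induction ha using Submodule.span_induction with
  | mem y hy =>
    obtain ⟨w, rfl⟩ := hy
    exact ⟨w.toList.length, Submodule.subset_span ⟨w.toList, le_refl w.toList.length, rfl⟩⟩
  | zero => exact ⟨0, zero_mem _⟩
  | add y z _ _ hy hz =>
    obtain ⟨m, hm⟩ := hy
    obtain ⟨k, hk⟩ := hz
    exact ⟨max m k, add_mem (wordSpan_mono R (le_max_left m k) hm)
      (wordSpan_mono R (le_max_right m k) hk)⟩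
  | smul r y _ hy =>
    obtain ⟨m, hm⟩ := hy
    exact ⟨m, Submodule.smul_mem _ r hm⟩

/-- A word is the product of its letters, and the nondecreasing products of basic commutators which
span it are the images of words of the same length. -/
theorem wordSpan_le_map (R : Type*) [CommRing R] (m : ℕ) :
    wordSpan R m ≤ (wordSpan R m).map (factorizationMap R) := by
  rw [wordSpan, Submodule.span_le]
  rintro _ ⟨w, hw, rfl⟩
  have hb : ∀ t ∈ w.map FreeMagma.of, IsBasicCommutator t := by
    intro t ht
    obtain ⟨i, -, rfl⟩ := List.mem_map.1 ht
    exact .letter i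
  have hl : totalLength (w.map FreeMagma.of) = w.length := by
    clear hw hb
    induction w with
    | nil => rfl
    | cons i w ih => rw [List.map_cons, totalLength_cons, ih, List.length_cons, add_comm]; rfl
  change basisFreeMonoid R (Fin 2) (FreeMonoid.ofList w) ∈ _
  rw [basisFreeMonoid_apply]
  refine Submodule.span_le.2 ?_ (ringCommutatorProd_mem_span_sorted R _ hb)
  rintro _ ⟨k, ⟨hk, hkl⟩, rfl⟩
  refine ⟨basisFreeMonoid R (Fin 2) (FreeMonoid.ofList (k.flatMap foliage)),
    Submodule.subset_span ⟨_, ?_, rfl⟩, ?_⟩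
  · change (k.flatMap foliage).length ≤ m
    rw [length_flatMap_foliage, hkl, hl]
    exact hw
  · rw [factorizationMap_basis, factorWord_flatMap hk]

theorem factorizationMap_surjective (R : Type*) [CommRing R] :
    Function.Surjective (factorizationMap R) := fun a => by
  obtain ⟨m, hm⟩ := exists_mem_wordSpan R a
  obtain ⟨b, -, hb⟩ := wordSpan_le_map R m hm
  exact ⟨b, hb⟩

/-- By `wordSpan_le_map`, every element of the finitely generated module spanned by the words of
length at most `m` is the image of an element of that module. By the Orzech property the
factorization map is therefore injective on it. -/
theorem factorizationMap_injective (R : Type*) [CommRing R] :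
    Function.Injective (factorizationMap R) := by
  rw [← LinearMap.ker_eq_bot, LinearMap.ker_eq_bot']
  intro z hz
  obtain ⟨m, hm⟩ := exists_mem_wordSpan R z
  have : Module.Finite R (wordSpan R m) := Module.Finite.iff_fg.2 (wordSpan_fg R m)
  let N : Submodule R (FreeAlgebra R (Fin 2)) :=
    wordSpan R m ⊓ (wordSpan R m).comap (factorizationMap R)
  let i : N →ₗ[R] wordSpan R m := Submodule.inclusion inf_le_left
  let f : N →ₗ[R] wordSpan R m :=
    (factorizationMap R).restrict (p := N) (q := wordSpan R m) fun y hy => hy.2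
  have hf : Function.Surjective f := by
    rintro ⟨a, ha⟩
    obtain ⟨b, hb, hba⟩ := wordSpan_le_map R m ha
    exact ⟨⟨b, hb, Submodule.mem_comap.2 (hba ▸ ha)⟩, Subtype.ext hba⟩
  have hinj := OrzechProperty.injective_of_surjective_of_injective i f
    (Submodule.inclusion_injective _) hf
  have hzN : z ∈ N := ⟨hm, Submodule.mem_comap.2 (hz ▸ zero_mem _)⟩
  have := @hinj ⟨z, hzN⟩ 0 (Subtype.ext (by rw [map_zero]; exact hz))
  exact congrArg Subtype.val this

/-- The values of the basic commutators in a ring are linearly independent over the integers, and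
remain so modulo every natural number `d`. -/
def BasicCommutatorsIndependent {A : Type*} [Ring A] (x : Fin 2 → A) : Prop :=
  ∀ (d : ℕ) (κ : Type) (s : Finset κ) (τ : κ → FreeMagma (Fin 2)) (e : κ → ℤ) (a : A),
    Function.Injective τ → (∀ t ∈ s, IsBasicCommutator (τ t)) →
    ∑ t ∈ s, e t • ringCommutator x (τ t) = d • a → ∀ t ∈ s, (d : ℤ) ∣ e t

/-- The basic commutators are independent in the free ring on two letters. -/
theorem exists_basicCommutatorsIndependent :
    ∃ (A : Type) (_ : Ring A) (x : Fin 2 → A), BasicCommutatorsIndependent x := by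
  refine ⟨FreeAlgebra ℤ (Fin 2), inferInstance, ι ℤ, fun d κ s τ e a hτ hs h t₀ ht₀ => ?_⟩
  obtain ⟨b, rfl⟩ := factorizationMap_surjective ℤ a
  set B := basisFreeMonoid ℤ (Fin 2)
  have hfol : ∀ t ∈ s, factorizationMap ℤ (B (FreeMonoid.ofList (foliage (τ t)))) =
      ringCommutator (ι ℤ) (τ t) := fun t ht => by
    rw [factorizationMap_basis, factorWord_foliage (hs t ht)]
    simp [ringCommutatorProd]
  have key : ∑ t ∈ s, e t • B (FreeMonoid.ofList (foliage (τ t))) = d • b := by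
    apply factorizationMap_injective ℤ
    rw [map_sum, map_nsmul, ← h]
    refine Finset.sum_congr rfl fun t ht => ?_
    rw [map_zsmul, hfol t ht]
  have hc := congrArg (fun y => B.repr y (FreeMonoid.ofList (foliage (τ t₀)))) key
  have hother : ∀ t ∈ s, t ≠ t₀ → (B.repr (e t • B (FreeMonoid.ofList (foliage (τ t)))))
      (FreeMonoid.ofList (foliage (τ t₀))) = 0 := by
    intro t ht hne
    have hw : FreeMonoid.ofList (foliage (τ t)) ≠ FreeMonoid.ofList (foliage (τ t₀)) := fun hw => by
      have h1 := factorWord_foliage (hs t ht)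
      rw [show foliage (τ t) = foliage (τ t₀) from hw, factorWord_foliage (hs t₀ ht₀)] at h1
      exact hne (hτ (List.cons.inj h1).1.symm)
    rw [map_zsmul, Finsupp.smul_apply, B.repr_self, Finsupp.single_eq_of_ne hw.symm, smul_zero]
  simp only [map_sum, Finsupp.finsetSum_apply] at hc
  rw [Finset.sum_eq_single_of_mem t₀ ht₀ hother, map_zsmul, map_nsmul, Finsupp.smul_apply,
    Finsupp.smul_apply, B.repr_self, Finsupp.single_eq_same] at hc
  exact ⟨_, by simpa using hc⟩

end FreeAlgebra

/-! ### The standard presentation of the nilpotent product of two cyclic groups -/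

section CyclicPresentation

open Monoid

/-- The commutator subgroup of the free product of two commutative groups is `[A, B]`. -/
theorem gammaTerm_two_coprod_le (A B : Type*) [CommGroup A] [CommGroup B] :
    gammaTerm (Coprod A B) 2 ≤ nilpotentProductKernel 1 A B := by
  set K := nilpotentProductKernel 1 A B
  have hA : ∀ (a : A) (u : Coprod A B), ⁅(Coprod.inl a : Coprod A B), u⁆ ∈ K := by
    intro a u
    rw [← QuotientGroup.eq_one_iff, ← QuotientGroup.mk'_apply, map_commutatorElement,
      commutatorElement_eq_one_iff_commute]
    induction u using Coprod.induction_on with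
    | inl a' => exact ((Commute.all a a').map Coprod.inl).map (QuotientGroup.mk' K)
    | inr b =>
      rw [← commutatorElement_eq_one_iff_commute, ← map_commutatorElement]
      exact (QuotientGroup.eq_one_iff _).2
        (Subgroup.commutator_mem_commutator ⟨a, rfl⟩ ⟨b, rfl⟩)
    | mul u v hu hv => rw [map_mul]; exact hu.mul_right hv
  have hB : ∀ (b : B) (u : Coprod A B), ⁅(Coprod.inr b : Coprod A B), u⁆ ∈ K := by
    intro b u
    induction u using Coprod.induction_on with
    | inl a => exact commutator_swap_mem (hA a _)
    | inr b' =>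
      rw [commutatorElement_eq_one_iff_commute.2 ((Commute.all b b').map Coprod.inr)]
      exact one_mem _
    | mul u v hu hv =>
      rw [← QuotientGroup.eq_one_iff, ← QuotientGroup.mk'_apply, map_commutatorElement,
        commutatorElement_eq_one_iff_commute] at hu hv ⊢
      rw [map_mul]
      exact hu.mul_right hv
  rw [gammaTerm_succ le_rfl, Subgroup.commutator_le]
  rintro u - v -
  induction u using Coprod.induction_on with
  | inl a => exact hA a v
  | inr b => exact hB b v
  | mul u w hu hw =>
    rw [← QuotientGroup.eq_one_iff, ← QuotientGroup.mk'_apply, map_commutatorElement,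
      commutatorElement_eq_one_iff_commute] at hu hw ⊢
    rw [map_mul]
    exact hu.mul_left hw

theorem nilpotentProductKernel_eq_gammaTerm {n : ℕ} (hn : 1 ≤ n) (A B : Type*) [CommGroup A]
    [CommGroup B] : nilpotentProductKernel n A B = gammaTerm (Coprod A B) (n + 1) := by
  have h : nilpotentProductKernel 1 A B = gammaTerm (Coprod A B) 2 :=
    le_antisymm (Subgroup.commutator_mono le_top le_top) (gammaTerm_two_coprod_le A B)
  have h' : nilpotentProductKernel n A B =
      iteratedCommutator (nilpotentProductKernel 1 A B) ⊤ (n - 1) := rfl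
  rw [h', h, iteratedCommutator_gammaTerm (by omega)]
  congr 1; omega

/-- The presentation of the nilpotent product of two cyclic groups by their generators. -/
def cyclicPresentation (r s n : ℕ) : FreeGroup (Fin 2) →* CyclicNilpotentProduct r s n :=
  (QuotientGroup.mk' _).comp (FreeGroup.lift
    ![Coprod.inl (Multiplicative.ofAdd (1 : ZMod r)),
      Coprod.inr (Multiplicative.ofAdd (1 : ZMod s))])

theorem cyclicPresentation_surjective (r s n : ℕ) :
    Function.Surjective (cyclicPresentation r s n) := by
  refine (QuotientGroup.mk'_surjective _).comp ?_
  have hz : ∀ (m : ℕ) (a : Multiplicative (ZMod m)),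
      ∃ k : ℤ, Multiplicative.ofAdd (1 : ZMod m) ^ k = a := fun m a => by
    obtain ⟨k, hk⟩ := ZMod.intCast_surjective a.toAdd
    exact ⟨k, by rw [← ofAdd_zsmul, zsmul_one, hk]; rfl⟩
  intro u
  induction u using Coprod.induction_on with
  | inl a =>
    obtain ⟨k, rfl⟩ := hz r a
    exact ⟨FreeGroup.of 0 ^ k, by simp⟩
  | inr b =>
    obtain ⟨k, rfl⟩ := hz s b
    exact ⟨FreeGroup.of 1 ^ k, by simp⟩
  | mul u v hu hv =>
    obtain ⟨u', rfl⟩ := hu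
    obtain ⟨v', rfl⟩ := hv
    exact ⟨u' * v', map_mul _ _ _⟩

theorem of_zero_pow_mem_ker (r s n : ℕ) :
    FreeGroup.of (0 : Fin 2) ^ r ∈ (cyclicPresentation r s n).ker := by
  rw [MonoidHom.mem_ker, cyclicPresentation, MonoidHom.comp_apply, map_pow, FreeGroup.lift_apply_of]
  simp only [Matrix.cons_val_zero]
  rw [← map_pow, ← ofAdd_nsmul]
  simp

theorem of_one_pow_mem_ker (r s n : ℕ) :
    FreeGroup.of (1 : Fin 2) ^ s ∈ (cyclicPresentation r s n).ker := by
  rw [MonoidHom.mem_ker, cyclicPresentation, MonoidHom.comp_apply, map_pow, FreeGroup.lift_apply_of]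
  simp only [Matrix.cons_val_one, Matrix.cons_val_zero]
  rw [← map_pow, ← ofAdd_nsmul]
  simp

theorem gammaTerm_le_ker (r s : ℕ) {n : ℕ} (hn : 1 ≤ n) :
    gammaTerm (FreeGroup (Fin 2)) (n + 1) ≤ (cyclicPresentation r s n).ker := by
  intro w hw
  rw [MonoidHom.mem_ker, cyclicPresentation, MonoidHom.comp_apply, QuotientGroup.mk'_apply,
    QuotientGroup.eq_one_iff, nilpotentProductKernel_eq_gammaTerm hn]
  exact map_gammaTerm_le _ _ ⟨w, hw, rfl⟩

/-- With `of_zero_pow_mem_ker`, `of_one_pow_mem_ker` and `gammaTerm_le_ker`: the kernel of the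
standard presentation is the smallest normal subgroup that contains `γ_(n+1)` and the `r`-th and
`s`-th powers of the respective generators. -/
theorem ker_cyclicPresentation_le {r s n : ℕ} (hn : 1 ≤ n) {E : Subgroup (FreeGroup (Fin 2))}
    [E.Normal] (h0 : FreeGroup.of 0 ^ r ∈ E) (h1 : FreeGroup.of 1 ^ s ∈ E)
    (hE : gammaTerm (FreeGroup (Fin 2)) (n + 1) ≤ E) : (cyclicPresentation r s n).ker ≤ E := by
  have hz : ∀ (m : ℕ) (i : Fin 2), FreeGroup.of i ^ m ∈ E →
      ∃ f : Multiplicative (ZMod m) →* FreeGroup (Fin 2) ⧸ E,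
        f (Multiplicative.ofAdd 1) = (FreeGroup.of i : FreeGroup (Fin 2)) := by
    intro m i hi
    refine ⟨(ZMod.lift m ⟨(zmultiplesHom (Additive (FreeGroup (Fin 2) ⧸ E)))
      (Additive.ofMul ((FreeGroup.of i : FreeGroup (Fin 2)) : FreeGroup (Fin 2) ⧸ E)),
        ?_⟩).toMultiplicativeLeft, ?_⟩
    · rw [zmultiplesHom_apply, natCast_zsmul, ← ofMul_pow, ← QuotientGroup.mk_pow,
        (QuotientGroup.eq_one_iff _).2 hi]
      rfl
    · change Additive.toMul (ZMod.lift m _ (1 : ZMod m)) = _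
      have : (1 : ZMod m) = ((1 : ℤ) : ZMod m) := by simp
      rw [this, ZMod.lift_coe]
      simp
  obtain ⟨f0, hf0⟩ := hz r 0 h0
  obtain ⟨f1, hf1⟩ := hz s 1 h1
  set f := Coprod.lift f0 f1 with hf
  have hker : nilpotentProductKernel n (Multiplicative (ZMod r)) (Multiplicative (ZMod s)) ≤
      f.ker := by
    rw [nilpotentProductKernel_eq_gammaTerm hn]
    intro u hu
    have h2 := map_gammaTerm_le f (n + 1) ⟨u, hu, rfl⟩
    have h3 : gammaTerm (FreeGroup (Fin 2) ⧸ E) (n + 1) = ⊥ := by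
      have := Subgroup.map_lowerCentralSeries (⊤ : Subgroup (FreeGroup (Fin 2)))
        (QuotientGroup.mk' E) n
      rw [Subgroup.map_top_of_surjective _ (QuotientGroup.mk'_surjective E)] at this
      change Subgroup.lowerCentralSeries ⊤ n = ⊥
      rw [← this, Subgroup.map_eq_bot_iff, QuotientGroup.ker_mk']
      exact hE
    rw [h3] at h2
    exact h2
  -- The presentation followed by the map induced by `f` is the projection to the quotient by `E`.
  have hcomp : (QuotientGroup.lift _ f hker).comp (cyclicPresentation r s n) =
      QuotientGroup.mk' E := by
    ext i
    fin_cases i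
    · simpa [cyclicPresentation, hf] using hf0
    · simpa [cyclicPresentation, hf] using hf1
  intro w hw
  rw [← QuotientGroup.eq_one_iff, ← QuotientGroup.mk'_apply, ← hcomp, MonoidHom.comp_apply,
    MonoidHom.mem_ker.1 hw, map_one]

end CyclicPresentation

/-! ### Products of powers in a group with a commutative quotient -/

section PowerProduct

variable {Γ ι : Type*} [Group Γ] [Fintype ι]

/-- The product of the powers `γ t ^ e t`, taken in some fixed order of the index type. -/
noncomputable def powerProduct (γ : ι → Γ) (e : ι → ℤ) : Γ :=
  ((Finset.univ : Finset ι).toList.map fun t => γ t ^ e t).prod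

theorem powerProduct_mem {γ : ι → Γ} {e : ι → ℤ} {H : Subgroup Γ}
    (h : ∀ t, γ t ^ e t ∈ H) : powerProduct γ e ∈ H := by
  apply list_prod_mem
  intro y hy
  obtain ⟨t, -, rfl⟩ := List.mem_map.1 hy
  exact h t

theorem map_powerProduct {C : Type*} [CommGroup C] (f : Γ →* C) (γ : ι → Γ) (e : ι → ℤ) :
    f (powerProduct γ e) = ∏ t, f (γ t) ^ e t := by
  rw [powerProduct, map_list_prod, List.map_map, ← Finset.prod_map_toList]
  simp only [Function.comp_def, map_zpow]

/-- In a commutative quotient, the power product is a homomorphism in the exponents. -/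
theorem exists_powerProduct_hom (M : Subgroup Γ) [M.Normal] (hM : ∀ a b : Γ, ⁅a, b⁆ ∈ M)
    (γ : ι → Γ) : ∃ Ψ : Multiplicative (ι → ℤ) →* Γ ⧸ M,
      ∀ e, Ψ (Multiplicative.ofAdd e) = (powerProduct γ e : Γ) := by
  let i : CommGroup (Γ ⧸ M) :=
    { (inferInstance : Group (Γ ⧸ M)) with
      mul_comm := fun a b => by
        induction a using QuotientGroup.induction_on with
        | H a =>
          induction b using QuotientGroup.induction_on with
          | H b =>
            have h := (QuotientGroup.eq_one_iff _).2 (hM a b)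
            rw [← QuotientGroup.mk'_apply, map_commutatorElement,
              commutatorElement_eq_one_iff_mul_comm] at h
            exact h }
  refine ⟨{ toFun := fun e => ∏ t, (γ t : Γ ⧸ M) ^ (Multiplicative.toAdd e t)
            map_one' := by simp
            map_mul' := fun e e' => by
              rw [← Finset.prod_mul_distrib]
              exact Finset.prod_congr rfl fun t _ => zpow_add _ _ _ }, fun e => ?_⟩
  exact (map_powerProduct (QuotientGroup.mk' M) γ e).symm

/-- If the elements `γ t` with `t ∈ S`, together with `M`, generate a subgroup containing `w`, then
`w` is a power product modulo `M`, with exponents supported in `S`. -/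
theorem exists_powerProduct_of_mem_closure (M : Subgroup Γ) [M.Normal]
    (hM : ∀ a b : Γ, ⁅a, b⁆ ∈ M) (γ : ι → Γ) (S : Set ι) {w : Γ}
    (hw : w ∈ Subgroup.closure (γ '' S ∪ M)) :
    ∃ e : ι → ℤ, (∀ t ∉ S, e t = 0) ∧ (powerProduct γ e)⁻¹ * w ∈ M := by
  classical
  obtain ⟨Ψ, hΨ⟩ := exists_powerProduct_hom M hM γ
  suffices h : ∃ e : ι → ℤ, (∀ t ∉ S, e t = 0) ∧ Ψ (Multiplicative.ofAdd e) = (w : Γ ⧸ M) by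
    obtain ⟨e, he, hw⟩ := h
    exact ⟨e, he, QuotientGroup.eq.1 ((hΨ e).symm.trans hw)⟩
  induction hw using Subgroup.closure_induction with
  | mem y hy =>
    rcases hy with ⟨t, ht, rfl⟩ | hy
    · refine ⟨Pi.single t 1, fun u hu => Pi.single_eq_of_ne (by rintro rfl; exact hu ht) _, ?_⟩
      rw [hΨ]
      congr 1
      rw [powerProduct, List.prod_map_eq_pow_single t]
      · simp [List.count_eq_one_of_mem (Finset.nodup_toList _)
          (Finset.mem_toList.2 (Finset.mem_univ t))]
      · intro u hu _
        rw [Pi.single_eq_of_ne hu, zpow_zero]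
    · exact ⟨0, fun _ _ => rfl, by
        rw [(QuotientGroup.eq_one_iff _).2 hy]; exact map_one Ψ⟩
  | one => exact ⟨0, fun _ _ => rfl, map_one Ψ⟩
  | mul y z _ _ hy hz =>
    obtain ⟨e, he, hy⟩ := hy
    obtain ⟨f, hf, hz⟩ := hz
    exact ⟨e + f, fun t ht => by rw [Pi.add_apply, he t ht, hf t ht, add_zero], by
      rw [ofAdd_add, map_mul, hy, hz, QuotientGroup.mk_mul]⟩
  | inv y _ hy =>
    obtain ⟨e, he, hy⟩ := hy
    exact ⟨-e, fun t ht => by rw [Pi.neg_apply, he t ht, neg_zero], by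
      rw [ofAdd_neg, map_inv, hy, QuotientGroup.mk_inv]⟩

/-- A commutative quotient in which the `γ t` generate, and in which the power products that vanish
are those with all exponents divisible by `d`, is a power of the cyclic group of order `d`. -/
theorem nonempty_mulEquiv_of_powerProduct (M : Subgroup Γ) [M.Normal]
    (hM : ∀ a b : Γ, ⁅a, b⁆ ∈ M) (γ : ι → Γ) (d : ℕ)
    (hgen : Subgroup.closure (Set.range γ ∪ M) = ⊤)
    (hker : ∀ e : ι → ℤ, powerProduct γ e ∈ M ↔ ∀ t, (d : ℤ) ∣ e t) :
    Nonempty (Γ ⧸ M ≃* Multiplicative (ι → ZMod d)) := by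
  obtain ⟨Ψ, hΨ⟩ := exists_powerProduct_hom M hM γ
  have hsurj : Function.Surjective Ψ := by
    intro q
    induction q using QuotientGroup.induction_on with
    | H w =>
      obtain ⟨e, -, he⟩ := exists_powerProduct_of_mem_closure M hM γ Set.univ (w := w)
        (by rw [Set.image_univ, hgen]; trivial)
      exact ⟨Multiplicative.ofAdd e, (hΨ e).trans (QuotientGroup.eq.2 he)⟩
  let ρ : Multiplicative (ι → ℤ) →* Multiplicative (ι → ZMod d) :=
    AddMonoidHom.toMultiplicative
      ((Int.castAddHom (ZMod d)).compLeft ι)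
  have hρ : Function.Surjective ρ := fun f => by
    choose e he using fun t => ZMod.intCast_surjective (Multiplicative.toAdd f t)
    exact ⟨Multiplicative.ofAdd e, funext he⟩
  have hk : Ψ.ker = ρ.ker := by
    ext e
    rw [MonoidHom.mem_ker, MonoidHom.mem_ker, ← ofAdd_toAdd e, hΨ, QuotientGroup.eq_one_iff, hker]
    change _ ↔ (fun t => ((Multiplicative.toAdd e t : ℤ) : ZMod d)) = fun _ => 0
    simp only [funext_iff, ← ZMod.intCast_zmod_eq_zero_iff_dvd]
  exact ⟨(QuotientGroup.quotientKerEquivOfSurjective Ψ hsurj).symm.trans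
    ((QuotientGroup.quotientMulEquivOfEq hk).trans
      (QuotientGroup.quotientKerEquivOfSurjective ρ hρ))⟩

end PowerProduct

/-! ### Powers of basic commutators modulo `[R, _c F]` -/

section Powers

variable {G : Type*} [Group G]

theorem pow_gcd_mem {H : Subgroup G} {g : G} {r s : ℕ} (hr : g ^ r ∈ H) (hs : g ^ s ∈ H) :
    g ^ Nat.gcd r s ∈ H := by
  rw [← zpow_natCast, Nat.gcd_eq_gcd_ab, zpow_add, zpow_mul, zpow_mul, zpow_natCast, zpow_natCast]
  exact mul_mem (zpow_mem hr _) (zpow_mem hs _)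

theorem mem_of_mk_eq {k : ℕ} {H : Subgroup G} (hH : gammaTerm G k ≤ H) {a b : G}
    (h : (a : G ⧸ gammaTerm G k) = b) (ha : b ∈ H) : a ∈ H := by
  have := hH (QuotientGroup.eq.1 h.symm)
  simpa using mul_mem ha this

theorem mul_pow_mem_of_mem_gammaTerm {k d : ℕ} {H : Subgroup G} (hH : gammaTerm G (k + 1) ≤ H)
    {a b : G} (ha : a ∈ gammaTerm G k) (hda : a ^ d ∈ H) (hdb : b ^ d ∈ H) :
    (a * b) ^ d ∈ H := by
  refine mem_of_mk_eq hH ?_ (mul_mem hda hdb)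
  simp only [QuotientGroup.mk_pow, QuotientGroup.mk_mul]
  exact (commute_mk_of_mem_gammaTerm ha _).mul_pow d

theorem commutator_mem_sup {H K : Subgroup G} [H.Normal] [K.Normal] {u : G} (hu : u ∈ H ⊔ K)
    (b : G) : ⁅u, b⁆ ∈ ⁅H, (⊤ : Subgroup G)⁆ ⊔ ⁅K, (⊤ : Subgroup G)⁆ := by
  obtain ⟨y, hy, z, hz, rfl⟩ := Subgroup.mem_sup_of_normal_right.1 hu
  have e : ⁅y * z, b⁆ = y * ⁅z, b⁆ * y⁻¹ * ⁅y, b⁆ := by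
    simp only [commutatorElement_def]; group
  rw [e]
  refine mul_mem (Subgroup.mem_sup_right ?_) (Subgroup.mem_sup_left
    (Subgroup.commutator_mem_commutator hy (Subgroup.mem_top b)))
  exact (Subgroup.commutator_normal K ⊤).conj_mem _
    (Subgroup.commutator_mem_commutator hz (Subgroup.mem_top b)) y

theorem commutator_pow_mem_of_mem_gammaTerm {k d : ℕ} {H : Subgroup G}
    (hH : gammaTerm G (k + 2) ≤ H) {a b : G} (ha : a ∈ gammaTerm G k) (h : ⁅a ^ d, b⁆ ∈ H) :
    ⁅a, b⁆ ^ d ∈ H := by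
  have hb : b ∈ gammaTerm G 1 := Subgroup.mem_top b
  refine mem_of_mk_eq hH ?_ h
  rw [QuotientGroup.mk_pow]
  exact (mk_commutator_pow_left ha hb rfl d).symm

/-- If `R` contains the `r`-th and `s`-th powers of the two generators, then modulo `γ_(k+2)` the
`gcd r s`-th powers of elements of `γ_(k+1)` lie in `[R, _k F]`. -/
theorem pow_gcd_mem_sup {r s : ℕ} {H : Subgroup (FreeGroup (Fin 2))} [H.Normal]
    (h0 : FreeGroup.of 0 ^ r ∈ H) (h1 : FreeGroup.of 1 ^ s ∈ H) {k : ℕ} (hk : 1 ≤ k)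
    {u : FreeGroup (Fin 2)} (hu : u ∈ gammaTerm (FreeGroup (Fin 2)) (k + 1)) :
    u ^ Nat.gcd r s ∈ iteratedCommutator H ⊤ k ⊔ gammaTerm (FreeGroup (Fin 2)) (k + 2) := by
  induction k, hk using Nat.le_induction generalizing u with
  | base =>
    have hgen : Subgroup.closure (Set.range (FreeGroup.of : Fin 2 → _)) = ⊤ :=
      FreeGroup.closure_range_of _
    rw [← basicTerm_eq_gammaTerm hgen (by norm_num : 1 ≤ 1 + 1)] at hu
    set T := iteratedCommutator H ⊤ 1 ⊔ gammaTerm (FreeGroup (Fin 2)) (1 + 2)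
    have hT : gammaTerm (FreeGroup (Fin 2)) (1 + 1 + 1) ≤ T := le_sup_right
    have hmem : ∀ {h b : FreeGroup (Fin 2)}, h ∈ H → ⁅h, b⁆ ∈ T := fun hh => Subgroup.mem_sup_left
      (Subgroup.commutator_mem_commutator hh (Subgroup.mem_top _))
    have hpow : ∀ (i j : Fin 2) (m : ℕ), FreeGroup.of i ^ m ∈ H →
        ⁅FreeGroup.of i, FreeGroup.of j⁆ ^ m ∈ T := fun i j m hi => by
      exact commutator_pow_mem_of_mem_gammaTerm (k := 1) hT (Subgroup.mem_top (FreeGroup.of i))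
        (hmem hi)
    induction hu using Subgroup.closure_induction with
    | mem y hy =>
      rcases hy with ⟨t, ht, htl, rfl⟩ | hy
      · obtain ⟨a, b, rfl⟩ : ∃ a b, t = FreeMagma.mul a b := by
          cases t with
          | of i => simp at htl
          | mul a b => exact ⟨a, b, rfl⟩
        obtain ⟨-, -, hlt, -⟩ := ht.of_mul
        have hab : a.length + b.length = 2 := htl
        have ha := a.length_pos
        have hb := b.length_pos
        cases a with
        | mul a₁ a₂ =>
          have := a₁.length_pos; have := a₂.length_pos
          simp only [FreeMagma.length] at hab; omega
        | of i =>
        cases b with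
        | mul b₁ b₂ =>
          have := b₁.length_pos; have := b₂.length_pos
          simp only [FreeMagma.length] at hab; omega
        | of j =>
        simp only [commutatorLT] at hlt
        obtain rfl : i = 1 := by omega
        obtain rfl : j = 0 := by omega
        change ⁅FreeGroup.of 1, FreeGroup.of 0⁆ ^ _ ∈ T
        refine pow_gcd_mem ?_ (hpow 1 0 s h1)
        rw [← commutatorElement_inv, inv_pow]
        exact inv_mem (hpow 0 1 r h0)
      · exact hT (pow_mem hy _)
    | one => rw [one_pow]; exact one_mem _
    | mul a b ha hb iha ihb =>
      exact mul_pow_mem_of_mem_gammaTerm hT (basicTerm_le_gammaTerm _ _ ha) iha ihb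
    | inv a ha iha => rw [inv_pow]; exact inv_mem iha
  | succ k hk ih =>
    set T := iteratedCommutator H ⊤ (k + 1) ⊔ gammaTerm (FreeGroup (Fin 2)) (k + 1 + 2)
    have hT : gammaTerm (FreeGroup (Fin 2)) (k + 1 + 1 + 1) ≤ T := le_sup_right
    have hmem := hu
    rw [gammaTerm_succ (by omega), Subgroup.commutator_def] at hmem
    clear hu
    have hle : ⁅gammaTerm (FreeGroup (Fin 2)) (k + 1), ⊤⁆ ≤ gammaTerm _ (k + 1 + 1) :=
      (gammaTerm_succ (by omega)).ge
    induction hmem using Subgroup.closure_induction with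
    | mem y hy =>
      obtain ⟨a, ha, b, -, rfl⟩ := hy
      have h := commutator_mem_sup (ih ha) b
      rw [← gammaTerm_succ (by omega)] at h
      exact commutator_pow_mem_of_mem_gammaTerm hT ha h
    | one => rw [one_pow]; exact one_mem _
    | mul a b ha hb iha ihb => exact mul_pow_mem_of_mem_gammaTerm hT (hle ha) iha ihb
    | inv a ha iha => rw [inv_pow]; exact inv_mem iha

end Powers

section BasicIndex

open PowerSeries

/-- The basic commutators of weights `c + 1, …, c + n`. -/
abbrev BasicIndex (c n : ℕ) : Type :=
  {t : FreeMagma (Fin 2) // IsBasicCommutator t ∧ c + 1 ≤ t.length ∧ t.length ≤ c + n}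

noncomputable instance (c n : ℕ) : Fintype (BasicIndex c n) :=
  ((finite_setOf_length_le (c + n)).subset fun _ h => h.2.2).fintype

/-- The value in `γ_(c+1)` of a basic commutator of weight at least `c + 1`. -/
def basicValue (c n : ℕ) (t : BasicIndex c n) : gammaTerm (FreeGroup (Fin 2)) (c + 1) :=
  ⟨groupCommutator FreeGroup.of t.1,
    gammaTerm_antitone t.2.2.1 (groupCommutator_mem_gammaTerm _ t.1)⟩

theorem card_basicIndex (c n : ℕ) :
    Fintype.card (BasicIndex c n) = ∑ i ∈ Finset.Icc 1 n, numBasicCommutators (c + i) := by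
  classical
  have hmaps : Set.MapsTo (fun t : BasicIndex c n => t.1.length - c)
      (Finset.univ : Finset (BasicIndex c n)) (Finset.Icc 1 n : Finset ℕ) := by
    intro t _
    have := t.2.2
    change t.1.length - c ∈ Finset.Icc 1 n
    rw [Finset.mem_Icc]
    omega
  rw [← Finset.card_univ, Finset.card_eq_sum_card_fiberwise hmaps]
  refine Finset.sum_congr rfl fun i hi => ?_
  rw [Finset.mem_Icc] at hi
  rw [numBasicCommutators, ← Set.ncard_coe_finset, ← Set.ncard_image_of_injective _
    Subtype.val_injective]
  congr 1
  ext t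
  constructor
  · rintro ⟨t, ht, rfl⟩
    have h1 : t.1.length - c = i := (Finset.mem_filter.1 ht).2
    have := t.2.2
    exact ⟨t.2.1, by omega⟩
  · rintro ⟨ht, htl⟩
    refine ⟨⟨t, ht, by omega, by omega⟩, ?_, rfl⟩
    rw [Finset.mem_coe, Finset.mem_filter]
    exact ⟨Finset.mem_univ _, by change t.length - c = i; omega⟩

theorem commutator_mem_subgroupOf {c n : ℕ} (hcn : n ≤ c + 1)
    {M : Subgroup (FreeGroup (Fin 2))} (hM : gammaTerm (FreeGroup (Fin 2)) (c + n + 1) ≤ M)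
    (a b : gammaTerm (FreeGroup (Fin 2)) (c + 1)) : ⁅a, b⁆ ∈ M.subgroupOf (gammaTerm _ (c + 1)) :=
  Subgroup.mem_subgroupOf.2 (hM (commutator_mem_gammaTerm a.2 b.2 (by omega)))

theorem gammaTerm_le_map_closure {c n k : ℕ} (hk : c + 1 ≤ k) (hkn : k ≤ c + n + 1) :
    gammaTerm (FreeGroup (Fin 2)) k ≤ (Subgroup.closure
      (basicValue c n '' {t | k ≤ t.1.length} ∪
        (gammaTerm (FreeGroup (Fin 2)) (c + n + 1)).subgroupOf (gammaTerm _ (c + 1)))).map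
      (Subgroup.subtype _) := by
  induction hkn using Nat.decreasingInduction with
  | self =>
    intro w hw
    exact ⟨⟨w, gammaTerm_antitone (by omega) hw⟩,
      Subgroup.subset_closure (Or.inr (Subgroup.mem_subgroupOf.2 hw)), rfl⟩
  | of_succ k hkn ih =>
    rw [← basicTerm_eq_gammaTerm (FreeGroup.closure_range_of _) (by omega : 1 ≤ k), basicTerm,
      Subgroup.closure_le]
    rintro w (⟨t, ht, rfl, rfl⟩ | hw)
    · exact ⟨basicValue c n ⟨t, ht, hk, by omega⟩,
        Subgroup.subset_closure (Or.inl ⟨_, le_refl t.length, rfl⟩), rfl⟩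
    · refine Subgroup.map_mono (Subgroup.closure_mono (Set.union_subset_union_left _
        (Set.image_mono ?_))) (ih (by omega) hw)
      exact fun t ht => le_trans (Nat.le_succ k) ht

/-- Elements of `γ_k` are products of powers of basic commutators of weight at least `k`, modulo
`γ_(c+n+1)`. -/
theorem exists_powerProduct_of_mem_gammaTerm {c n k : ℕ} (hcn : n ≤ c + 1) (hk : c + 1 ≤ k)
    (hkn : k ≤ c + n + 1) {w : FreeGroup (Fin 2)} (hw : w ∈ gammaTerm (FreeGroup (Fin 2)) k) :
    ∃ e : BasicIndex c n → ℤ, (∀ t, t.1.length < k → e t = 0) ∧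
      (powerProduct (basicValue c n) e).1⁻¹ * w ∈
        gammaTerm (FreeGroup (Fin 2)) (c + n + 1) := by
  obtain ⟨w', hw', rfl⟩ := gammaTerm_le_map_closure hk hkn hw
  obtain ⟨e, he, h⟩ := exists_powerProduct_of_mem_closure _
    (commutator_mem_subgroupOf hcn le_rfl) _ _ hw'
  exact ⟨e, fun t ht => he t (by change ¬ k ≤ _; omega), Subgroup.mem_subgroupOf.1 h⟩

variable {A : Type*} [Ring A] {x : Fin 2 → A}

/-- A product of powers of basic commutators whose Magnus expansion is trivial modulo `d` has all
exponents divisible by `d`. -/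
theorem dvd_of_magnus_powerProduct_mem (hx : BasicCommutatorsIndependent x) {c n d : ℕ}
    (hcn : n ≤ c + 1) {e : BasicIndex c n → ℤ}
    (h : magnus x (powerProduct (basicValue c n) e).1 ∈
      congruenceUnits A d n (c + 1)) (t : BasicIndex c n) : (d : ℤ) ∣ e t := by
  classical
  -- Induction on the weight `j` of `t`: in degree `j`, commutators of smaller weight contribute
  -- multiples of `d`, those of weight `j` their leading terms, and the others nothing.
  induction hj : t.1.length using Nat.strong_induction_on generalizing t with
  | _ j ih =>
  have htl := t.2.2
  have hj1 : 1 ≤ j := by omega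
  obtain ⟨a, ha⟩ := coeff_of_mem_truncationIdeal (mem_congruenceUnits.1 h)
    (by omega : j < c + 1 + n)
  rw [map_sub, coeff_one, if_neg (by omega), sub_zero] at ha
  have hsum := map_powerProduct (magnusCoeff x hj1 (by omega : j < 2 * (c + 1)))
    (basicValue c n) e
  replace hsum := congrArg Multiplicative.toAdd hsum
  change coeff j (magnus x (powerProduct (basicValue c n) e).1 : A⟦X⟧) = _ at hsum
  rw [ha, toAdd_prod] at hsum
  simp only [toAdd_zpow] at hsum
  set v : BasicIndex c n → A := fun u =>
    Multiplicative.toAdd (magnusCoeff x hj1 (by omega : j < 2 * (c + 1)) (basicValue c n u)) with hv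
  have hv' : ∀ u, v u =
      coeff j (magnus x (groupCommutator FreeGroup.of u.1) : A⟦X⟧) := fun _ => rfl
  choose! f hf using fun (u : BasicIndex c n) (hu : u.1.length < j) => ih _ hu u rfl
  have key : ∑ u ∈ Finset.univ.filter (fun u : BasicIndex c n => u.1.length = j),
      e u • ringCommutator x u.1 =
      d • (a - ∑ u ∈ Finset.univ.filter (fun u : BasicIndex c n => u.1.length < j), f u • v u) := by
    rw [smul_sub, hsum, Finset.smul_sum, eq_sub_iff_add_eq, Finset.sum_filter, Finset.sum_filter,
      ← Finset.sum_add_distrib]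
    refine Finset.sum_congr rfl fun u _ => ?_
    rcases lt_trichotomy u.1.length j with hu | hu | hu
    · rw [if_neg hu.ne, if_pos hu, zero_add]
      change _ = e u • v u
      rw [hf u hu, mul_smul, natCast_zsmul]
    · rw [if_pos hu, if_neg hu.not_lt, add_zero]
      change _ = e u • v u
      rw [hv', ← hu, coeff_magnus_groupCommutator]
    · rw [if_neg hu.ne', if_neg (by omega), add_zero]
      change _ = e u • v u
      rw [hv', coeff_magnus_of_lt x (groupCommutator_mem_gammaTerm _ u.1) hj1 hu, smul_zero]
  exact hx d _ _ Subtype.val e _ Subtype.val_injective (fun u _ => u.2.1) key t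
    (Finset.mem_filter.2 ⟨Finset.mem_univ _, hj⟩)

/-- Elements of `γ_k` with trivial Magnus expansion modulo `d` are `d`-th powers of elements of
`γ_k`, modulo `γ_(c+n+1)`. -/
theorem exists_pow_of_magnus_mem (hx : BasicCommutatorsIndependent x) {c n d k : ℕ}
    (hcn : n ≤ c + 1) (hk : c + 1 ≤ k) (hkn : k ≤ c + n + 1) {w : FreeGroup (Fin 2)}
    (hw : w ∈ gammaTerm (FreeGroup (Fin 2)) k)
    (h : magnus x w ∈ congruenceUnits A d n (c + 1)) :
    ∃ u ∈ gammaTerm (FreeGroup (Fin 2)) k,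
      (u ^ d)⁻¹ * w ∈ gammaTerm (FreeGroup (Fin 2)) (c + n + 1) := by
  obtain ⟨e, he, hew⟩ := exists_powerProduct_of_mem_gammaTerm hcn hk hkn hw
  have htail : ∀ z ∈ gammaTerm (FreeGroup (Fin 2)) (c + n + 1),
      magnus x z ∈ congruenceUnits A d n (c + 1) := fun z hz => by
    obtain ⟨P, hP⟩ := mem_congruenceUnits_one.1 (magnus_mem_of_mem_gammaTerm x hz)
    rw [mem_congruenceUnits, hP, add_sub_cancel_left, show c + n + 1 = c + 1 + n by omega]
    exact X_pow_mem_truncationIdeal _ _ _ _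
  have hdvd := dvd_of_magnus_powerProduct_mem hx hcn (e := e) (d := d) (by
    have := mul_mem h (inv_mem (htail _ hew))
    rw [← map_inv, ← map_mul] at this
    simpa using this)
  -- Exponents that vanish are kept at zero by integer division, also for `d = 0`.
  set e' : BasicIndex c n → ℤ := fun t => e t / d
  obtain ⟨Ψ, hΨ⟩ := exists_powerProduct_hom
    ((gammaTerm (FreeGroup (Fin 2)) (c + n + 1)).subgroupOf (gammaTerm _ (c + 1)))
    (commutator_mem_subgroupOf hcn le_rfl) (basicValue c n)
  refine ⟨(powerProduct (basicValue c n) e').1, ?_, ?_⟩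
  · have : powerProduct (basicValue c n) e' ∈
        (gammaTerm (FreeGroup (Fin 2)) k).subgroupOf (gammaTerm _ (c + 1)) := by
      refine powerProduct_mem fun t => ?_
      rcases lt_or_ge t.1.length k with ht | ht
      · rw [show e' t = 0 by simp [e', he t ht], zpow_zero]; exact one_mem _
      · exact zpow_mem (Subgroup.mem_subgroupOf.2
          (gammaTerm_antitone ht (groupCommutator_mem_gammaTerm _ t.1))) _
    exact this
  · have h1 : Multiplicative.ofAdd e = Multiplicative.ofAdd e' ^ d := by
      rw [← ofAdd_nsmul]
      congr 1
      funext t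
      rw [Pi.smul_apply, nsmul_eq_mul, Int.mul_ediv_cancel' (hdvd t)]
    have h2 := hΨ e
    rw [h1, map_pow, hΨ, ← QuotientGroup.mk_pow, QuotientGroup.eq] at h2
    have h3 : ((powerProduct (basicValue c n) e').1 ^ d)⁻¹ *
        (powerProduct (basicValue c n) e).1 ∈
        gammaTerm (FreeGroup (Fin 2)) (c + n + 1) := Subgroup.mem_subgroupOf.1 h2
    have := mul_mem h3 hew
    rwa [mul_assoc, mul_inv_cancel_left] at this

theorem exists_one_add_pow (P : A⟦X⟧) (d : ℕ) :
    ∃ Q : A⟦X⟧, (1 + P) ^ d = 1 + d • P + P * P * Q := by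
  induction d with
  | zero => exact ⟨0, by simp⟩
  | succ d ih =>
    obtain ⟨Q, hQ⟩ := ih
    refine ⟨(d : A⟦X⟧) + Q + P * Q, ?_⟩
    rw [pow_succ', hQ, succ_nsmul, nsmul_eq_mul]
    have hc : P * (d : A⟦X⟧) = d * P := ((Nat.cast_commute d P).eq).symm
    simp only [mul_add, add_mul, one_mul, mul_one, mul_assoc, ← hc]
    abel

/-- The `d`-th power of `1 + X ^ (c + 1) P` is `1 + d X ^ (c + 1) P` up to `X ^ (2 c + 2)`. -/
theorem magnus_pow_mem {c n k : ℕ} (hcn : n ≤ c + 1) (hk : c + 1 ≤ k) (d : ℕ)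
    {u : FreeGroup (Fin 2)} (hu : u ∈ gammaTerm (FreeGroup (Fin 2)) k) :
    magnus x (u ^ d) ∈ congruenceUnits A d n (c + 1) := by
  obtain ⟨P, hP⟩ := mem_congruenceUnits_one.1
    (magnus_mem_of_mem_gammaTerm x (gammaTerm_antitone hk hu))
  obtain ⟨Q, hQ⟩ := exists_one_add_pow (X ^ (c + 1) * P) d
  rw [mem_congruenceUnits, map_pow, Units.val_pow_eq_pow_val, hP, hQ, add_assoc,
    add_sub_cancel_left]
  refine add_mem (smul_mem_truncationIdeal _ _ _ _) ?_
  have e : X ^ (c + 1) * P * (X ^ (c + 1) * P) * Q = X ^ (c + 1 + (c + 1)) * (P * (P * Q)) := by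
    simp only [mul_assoc]
    rw [← mul_assoc P (X ^ (c + 1)), ← X_pow_mul (φ := P), mul_assoc (X ^ (c + 1)) P,
      ← mul_assoc (X ^ (c + 1)), ← pow_add]
  rw [e]
  exact truncationIdeal_antitone d n (by omega : c + 1 ≤ c + 1 + (c + 1) - n) (by
    have := X_pow_mem_truncationIdeal d n (c + 1 + (c + 1) - n) (P * (P * Q))
    rw [Nat.sub_add_cancel (by omega)] at this
    simpa only [mul_assoc] using this)

end BasicIndex

/-! ### The Baer invariant of the nilpotent product -/

section BaerInvariant

variable {A : Type*} [Ring A] {x : Fin 2 → A} {r s n c : ℕ}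

theorem magnus_mem_of_mem_iteratedCommutator_ker (hn : 1 ≤ n)
    (hr : ∀ i, 1 ≤ i → i ≤ n → r ∣ r.choose i) (hs : ∀ i, 1 ≤ i → i ≤ n → s ∣ s.choose i)
    {w : FreeGroup (Fin 2)} (hw : w ∈ iteratedCommutator (cyclicPresentation r s n).ker ⊤ c) :
    magnus x w ∈ congruenceUnits A (Nat.gcd r s) n (c + 1) := by
  have h : (cyclicPresentation r s n).ker ≤
      (congruenceUnits A (Nat.gcd r s) n 1).comap (magnus x) := by
    apply ker_cyclicPresentation_le hn
    · rw [Subgroup.mem_comap, map_pow, magnus_of]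
      exact oneAddX_pow_mem_congruenceUnits _ fun i h1 h2 =>
        (Nat.gcd_dvd_left r s).trans (hr i h1 h2)
    · rw [Subgroup.mem_comap, map_pow, magnus_of]
      exact oneAddX_pow_mem_congruenceUnits _ fun i h1 h2 =>
        (Nat.gcd_dvd_right r s).trans (hs i h1 h2)
    · intro w hw
      obtain ⟨P, hP⟩ := mem_congruenceUnits_one.1 (magnus_mem_of_mem_gammaTerm x hw)
      rw [Subgroup.mem_comap, mem_congruenceUnits, hP, add_sub_cancel_left, add_comm n]
      exact X_pow_mem_truncationIdeal _ _ _ _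
  rw [add_comm c]
  exact iteratedCommutator_le_comap_congruenceUnits x h c hw

theorem gammaTerm_le_iteratedCommutator_ker (r s : ℕ) (hn : 1 ≤ n) (c : ℕ) :
    gammaTerm (FreeGroup (Fin 2)) (c + n + 1) ≤
      iteratedCommutator (cyclicPresentation r s n).ker ⊤ c := by
  have h := iteratedCommutator_mono (gammaTerm_le_ker r s hn) c
  rwa [iteratedCommutator_gammaTerm (by omega), show n + 1 + c = c + n + 1 by omega] at h

/-- The `gcd r s`-th powers of elements of `γ_k`, for `k > c`, lie in `[R, _c F]`. Modulo an element
of `[R, _c F]` such a power lies in `γ_(k+1)`, and by its Magnus expansion it is there again a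
`gcd r s`-th power up to `γ_(c+n+1)`. -/
theorem pow_mem_iteratedCommutator_ker (hx : BasicCommutatorsIndependent x) (hn : 1 ≤ n)
    (hnc : n ≤ c) (hr : ∀ i, 1 ≤ i → i ≤ n → r ∣ r.choose i)
    (hs : ∀ i, 1 ≤ i → i ≤ n → s ∣ s.choose i) {k : ℕ} (hkn : k ≤ c + n + 1) (hk : c + 1 ≤ k)
    {u : FreeGroup (Fin 2)} (hu : u ∈ gammaTerm (FreeGroup (Fin 2)) k) :
    u ^ Nat.gcd r s ∈ iteratedCommutator (cyclicPresentation r s n).ker ⊤ c := by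
  induction hkn using Nat.decreasingInduction generalizing u with
  | self => exact gammaTerm_le_iteratedCommutator_ker r s hn c (pow_mem hu _)
  | of_succ k hkn ih =>
    obtain ⟨k, rfl⟩ := Nat.exists_eq_add_of_le' (by omega : 1 ≤ k)
    have h := pow_gcd_mem_sup (of_zero_pow_mem_ker r s n) (of_one_pow_mem_ker r s n)
      (by omega : 1 ≤ k) hu
    obtain ⟨y, hy, v, hv, hyv⟩ := Subgroup.mem_sup_of_normal_right.1 h
    have hyN := iteratedCommutator_antitone (cyclicPresentation r s n).ker (by omega : c ≤ k) hy
    have hvK : magnus x v ∈ congruenceUnits A (Nat.gcd r s) n (c + 1) := by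
      rw [eq_inv_mul_of_mul_eq hyv, map_mul, map_inv]
      exact mul_mem (inv_mem (magnus_mem_of_mem_iteratedCommutator_ker hn hr hs hyN))
        (magnus_pow_mem (by omega) hk _ hu)
    obtain ⟨u', hu', hv'⟩ := exists_pow_of_magnus_mem hx (by omega) (by omega) (by omega) hv hvK
    rw [← hyv]
    refine mul_mem hyN ?_
    have := mul_mem (ih (by omega) hu') (gammaTerm_le_iteratedCommutator_ker r s hn c hv')
    rwa [mul_inv_cancel_left] at this

theorem nonempty_gammaTerm_quotient_mulEquiv (hx : BasicCommutatorsIndependent x)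
    (hn : 1 ≤ n) (hnc : n ≤ c) (hr : ∀ i, 1 ≤ i → i ≤ n → r ∣ r.choose i)
    (hs : ∀ i, 1 ≤ i → i ≤ n → s ∣ s.choose i) :
    Nonempty (gammaTerm (FreeGroup (Fin 2)) (c + 1) ⧸
      (iteratedCommutator (cyclicPresentation r s n).ker ⊤ c).subgroupOf (gammaTerm _ (c + 1)) ≃*
        Multiplicative (BasicIndex c n → ZMod (Nat.gcd r s))) := by
  have hγN := gammaTerm_le_iteratedCommutator_ker r s hn c
  refine nonempty_mulEquiv_of_powerProduct _ (commutator_mem_subgroupOf (by omega) hγN)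
    (basicValue c n) _ ?_ fun e => ⟨fun h => ?_, fun h => ?_⟩
  · rw [eq_top_iff]
    intro w _
    obtain ⟨w', hw', hww'⟩ := gammaTerm_le_map_closure le_rfl (by omega : c + 1 ≤ c + n + 1) w.2
    obtain rfl : w' = w := Subtype.ext hww'
    refine Subgroup.closure_mono (Set.union_subset_union (Set.image_subset_range _ _) ?_) hw'
    exact fun z hz => hγN hz
  · exact dvd_of_magnus_powerProduct_mem hx (by omega)
      (magnus_mem_of_mem_iteratedCommutator_ker hn hr hs (Subgroup.mem_subgroupOf.1 h))
  · refine powerProduct_mem fun t => ?_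
    obtain ⟨m, hm⟩ := h t
    rw [hm, mul_comm, zpow_mul, zpow_natCast]
    exact Subgroup.mem_subgroupOf.2 (pow_mem_iteratedCommutator_ker hx hn hnc hr hs (by omega)
      le_rfl (SetLike.coe_mem (basicValue c n t ^ m)))

theorem nonempty_baerInvariant_mulEquiv (hn : 1 ≤ n) (hnc : n ≤ c)
    (hr : ∀ i, 1 ≤ i → i ≤ n → r ∣ r.choose i) (hs : ∀ i, 1 ≤ i → i ≤ n → s ∣ s.choose i)
    {F : Type*} [Group F] [IsFreeGroup F] {π : F →* CyclicNilpotentProduct r s n}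
    (hπ : Function.Surjective π) :
    Nonempty (BaerInvariant c π ≃* Multiplicative
      (Fin (∑ i ∈ Finset.Icc 1 n, numBasicCommutators (c + i)) → ZMod (Nat.gcd r s))) := by
  obtain ⟨A, _, x, hx⟩ := exists_basicCommutatorsIndependent
  obtain ⟨f⟩ := BaerInvariant.nonempty_mulEquiv c hπ (cyclicPresentation_surjective r s n)
  have hle : gammaTerm (FreeGroup (Fin 2)) (c + 1) ≤ (cyclicPresentation r s n).ker :=
    (gammaTerm_antitone (by omega)).trans (gammaTerm_le_ker r s hn)
  have htransport : ∀ T T' N : Subgroup (FreeGroup (Fin 2)), T = T' → ∀ [N.Normal],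
      Nonempty (T ⧸ N.subgroupOf T ≃* T' ⧸ N.subgroupOf T') := by
    rintro T _ N rfl _
    exact ⟨MulEquiv.refl _⟩
  obtain ⟨g⟩ := htransport _ _ (iteratedCommutator (cyclicPresentation r s n).ker ⊤ c)
    (inf_eq_right.2 hle)
  obtain ⟨h⟩ := nonempty_gammaTerm_quotient_mulEquiv hx hn hnc hr hs
  have e : BasicIndex c n ≃ Fin (∑ i ∈ Finset.Icc 1 n, numBasicCommutators (c + i)) :=
    Fintype.equivFinOfCardEq (card_basicIndex c n)
  exact ⟨f.trans (g.trans (h.trans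
    (AddEquiv.toMultiplicative (AddEquiv.arrowCongr e (AddEquiv.refl (ZMod (Nat.gcd r s)))))))⟩

end BaerInvariant

/-- A number prime to `n!` divides its binomial coefficients with lower index `1, …, n`. -/
theorem dvd_choose_of_coprime_factorial {r n : ℕ} (h : Nat.Coprime r n.factorial) :
    ∀ i, 1 ≤ i → i ≤ n → r ∣ r.choose i := by
  intro i h1 hi
  have hc : Nat.Coprime r i.factorial := h.coprime_dvd_right (Nat.factorial_dvd_factorial hi)
  refine hc.dvd_of_dvd_mul_left ?_
  rw [← Nat.descFactorial_eq_factorial_mul_choose]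
  obtain ⟨i, rfl⟩ := Nat.exists_eq_add_of_le' h1
  rcases r with _ | r
  · simp
  · rw [Nat.succ_descFactorial_succ]
    exact dvd_mul_right _ _

theorem theorem3p5 :
    -- n = 2, with r and s odd
    (∀ r s c : ℕ, Odd r → Odd s → 2 ≤ c →
      ∀ (F : Type*) [Group F] [IsFreeGroup F] (π : F →* CyclicNilpotentProduct r s 2),
        Function.Surjective π →
        Nonempty (BaerInvariant c π ≃*
          Multiplicative (Fin (∑ i ∈ Finset.Icc 1 2, numBasicCommutators (c + i)) →
            ZMod (Nat.gcd r s)))) ∧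
    (∀ r s : ℕ, ¬ 2 ∣ r → ¬ 3 ∣ r → ¬ 2 ∣ s → ¬ 3 ∣ s →
      -- n = 3
      (∀ c : ℕ, 3 ≤ c →
        ∀ (F : Type*) [Group F] [IsFreeGroup F] (π : F →* CyclicNilpotentProduct r s 3),
          Function.Surjective π →
          Nonempty (BaerInvariant c π ≃*
            Multiplicative (Fin (∑ i ∈ Finset.Icc 1 3, numBasicCommutators (c + i)) →
              ZMod (Nat.gcd r s)))) ∧
      -- n = 4
      (∀ c : ℕ, 4 ≤ c →
        ∀ (F : Type*) [Group F] [IsFreeGroup F] (π : F →* CyclicNilpotentProduct r s 4),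
          Function.Surjective π →
          Nonempty (BaerInvariant c π ≃*
            Multiplicative (Fin (∑ i ∈ Finset.Icc 1 4, numBasicCommutators (c + i)) →
              ZMod (Nat.gcd r s))))) := by
  have hprime : ∀ {r : ℕ}, ¬ 2 ∣ r → ¬ 3 ∣ r → Nat.Coprime r (Nat.factorial 4) := by
    intro r h2 h3
    have h2' : Nat.Coprime r 2 := ((Nat.prime_two.coprime_iff_not_dvd).2 h2).symm
    have h3' : Nat.Coprime r 3 := ((Nat.prime_three.coprime_iff_not_dvd).2 h3).symm
    rw [show Nat.factorial 4 = 2 ^ 3 * 3 from rfl]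
    exact (h2'.pow_right 3).mul_right h3'
  refine ⟨fun r s c hr hs hc F _ _ π hπ => ?_, fun r s hr2 hr3 hs2 hs3 =>
    ⟨fun c hc F _ _ π hπ => ?_, fun c hc F _ _ π hπ => ?_⟩⟩
  · exact nonempty_baerInvariant_mulEquiv (by norm_num) hc
      (dvd_choose_of_coprime_factorial (Nat.coprime_two_right.2 hr))
      (dvd_choose_of_coprime_factorial (Nat.coprime_two_right.2 hs)) hπ
  · have h : Nat.factorial 3 ∣ Nat.factorial 4 := Nat.factorial_dvd_factorial (by norm_num)
    exact nonempty_baerInvariant_mulEquiv (by norm_num) hc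
      (dvd_choose_of_coprime_factorial ((hprime hr2 hr3).coprime_dvd_right h))
      (dvd_choose_of_coprime_factorial ((hprime hs2 hs3).coprime_dvd_right h)) hπ
  · exact nonempty_baerInvariant_mulEquiv (by norm_num) hc
      (dvd_choose_of_coprime_factorial (hprime hr2 hr3))
      (dvd_choose_of_coprime_factorial (hprime hs2 hs3)) hπ
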